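/- **Conventions.** $\|\cdot\|$ is the spectral norm. Every operator $A$ on $m$ qubits has a unique Pauli expansion $A=\sum_{\sigma\in\{0,1,2,3\}^m}\widehat A(\sigma)\,P_{\sigma_1}\otimes\cdots\otimes P_{\sigma_m}$ with $P_0,\dots,P_3=I,X,Y,Z$. Its degree is $\deg(A)=\max\{|\{i:\sigma_i\ne0\}|:\widehat A(\sigma)\neq 0\}$ (and $\deg(0)=0$), and its approximate degree is $\deg_\varepsilon(A)=\min\{\deg(B):\|A-B\|\le\varepsilon\}$ for $\varepsilon\ge0$. A depth-$d$ QAC circuit is a unitary $U=L_dM_d\cdots L_1M_1L_0$, where each $L_i$ is a tensor product of single-qubit unitaries and each $M_i$ is a tensor product of controlled-$Z$ gates $I-2|1\cdots1\rangle\langle1\cdots1|$ of arbitrary arity acting on pairwise disjoint sets of qubits. If $U$ acts on $n$ input qubits and $a$ ancilla qubits, $\psi$ is a density operator on the ancillae, and $k\le n$, let $\mathcal E_{U,\psi}(\rho)=\mathrm{Tr}_{[k]^c}\big(U(\rho\otimes\psi)U^\dagger\big)$ be the channel from $n$ qubits to the first $k$ qubits. For a linear map $\mathcal E$ from operators on $n$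 qubits to operators on $k$ qubits, its Choi operator is $\Phi_{\mathcal E}=(\mathcal E\otimes\mathrm{id})\big(\sum_{x,y\in\{0,1\}^n}|x\rangle\langle y|\otimes|x\rangle\langle y|\big)$, an operator on $k+n$ qubits, and its completely bounded spectral norm is $\|\mathcal E\|_{\mathrm{cb}}=\sup\{\|(\mathcal E\otimes\mathrm{id})(X)\|:\|X\|\le1\}$, the supremum being over operators $X$ on the input and any finite-dimensional reference system. Write $\Phi_{U,\psi}=\Phi_{\mathcal E_{U,\psi}}$. **Theorem.** There are absolute constants $C_1,C_2>0$ and $c\in\mathbb N$ such that the following holds for all integers $n\ge1$, $a\ge0$, $d\ge1$, $0\le k\le n$, every depth-$d$ QAC circuit $U$ on $n$ input qubits and $a$ ancillae, and every density operator $\psi$ on the ancillae. Put $$\ell=C_2\,(n+a)^{1-3^{-d}}\,k^{3^{-d}/2}\,\big(1+\log(n+a)\big)^c .$$ 1. $\deg_{C_1d/n}\big(2^{-k}\Phi_{U,\psi}\big)\le \ell$. 2. For every quantum channel (completely positive trace-preserving map) $\mathcal E$ from $n$ qubits to $k$ qubits and every $0\le\varepsilon\le1$ with $\|\mathcal E-\mathcal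 E_{U,\psi}\|_{\mathrm{cb}}\le\varepsilon$, one has $\deg_{\varepsilon+C_1d/n}\big(2^{-k}\Phi_{\mathcal E}\big)\le\ell$. -/

import Mathlib

open scoped Matrix.Norms.L2Operator ENNReal ComplexOrder

noncomputable section

/-- Operators on a register of qubits labelled by `ι`, in the computational basis `ι → Fin 2`.
The norm `‖·‖` on matrices is the spectral norm (the `ℓ²` operator norm). -/
abbrev QOp (ι : Type) : Type := Matrix (ι → Fin 2) (ι → Fin 2) ℂ

/-! ### Pauli degree and approximate degree -/

/-- The Pauli matrices `I, X, Y, Z`, numbered from `0` to `3`. -/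
def pauli : Fin 4 → Matrix (Fin 2) (Fin 2) ℂ :=
  ![1, !![0, 1; 1, 0], !![0, -Complex.I; Complex.I, 0], !![1, 0; 0, -1]]

/-- The tensor product `⨂ i, A i` of single-qubit operators. -/
def tensorOp {ι : Type} [Fintype ι] (A : ι → Matrix (Fin 2) (Fin 2) ℂ) : QOp ι :=
  Matrix.of fun x y => ∏ i, A i (x i) (y i)

/-- The Pauli string with letters `σ i`. -/
def pauliString {ι : Type} [Fintype ι] (σ : ι → Fin 4) : QOp ι :=
  tensorOp fun i => pauli (σ i)

/-- The coefficient of `A` at the Pauli string `σ`: the normalized Hilbert-Schmidt inner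
product of the string with `A`. -/
def pauliCoeff {ι : Type} [Fintype ι] [DecidableEq ι] (A : QOp ι) (σ : ι → Fin 4) : ℂ :=
  ((2 : ℂ) ^ Fintype.card ι)⁻¹ * ((pauliString σ).conjTranspose * A).trace

/-- The number of qubits on which a Pauli string is not the identity. -/
def pauliWeight {ι : Type} [Fintype ι] (σ : ι → Fin 4) : ℕ :=
  (Finset.univ.filter fun i => σ i ≠ 0).card

/-- The largest weight of a Pauli string with nonzero coefficient (`0` for `A = 0`). -/
def pauliDegree {ι : Type} [Fintype ι] [DecidableEq ι] (A : QOp ι) : ℕ :=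
  open Classical in
  (Finset.univ.filter fun σ : ι → Fin 4 => pauliCoeff A σ ≠ 0).sup pauliWeight

/-- The least Pauli degree of an operator within spectral distance `ε` of `A`
(there is such an operator, namely `A`, as soon as `0 ≤ ε`). -/
def approxDegree {ι : Type} [Fintype ι] [DecidableEq ι] (ε : ℝ) (A : QOp ι) : ℕ :=
  sInf {m : ℕ | ∃ B : QOp ι, ‖A - B‖ ≤ ε ∧ pauliDegree B = m}

/-! ### QAC circuits -/

/-- The controlled-`Z` gate on the set `S` of qubits, `1 - 2 |1⋯1⟩⟨1⋯1|` on `S` and the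
identity on the other qubits. -/
def czGate {ι : Type} [Fintype ι] [DecidableEq ι] (S : Finset ι) : QOp ι :=
  1 - (2 : ℂ) • Matrix.diagonal fun x => if ∀ i ∈ S, x i = 1 then 1 else 0

/-- A layer of single-qubit unitaries. -/
def IsLocalLayer {ι : Type} [Fintype ι] (L : QOp ι) : Prop :=
  ∃ u : ι → Matrix (Fin 2) (Fin 2) ℂ,
    (∀ i, u i ∈ Matrix.unitaryGroup (Fin 2) ℂ) ∧ L = tensorOp u

/-- A layer of controlled-`Z` gates of arbitrary arity, on pairwise disjoint sets of qubits. -/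
def IsCZLayer {ι : Type} [Fintype ι] [DecidableEq ι] (M : QOp ι) : Prop :=
  ∃ gates : List (Finset ι), (∀ S ∈ gates, S.Nonempty) ∧ gates.Pairwise Disjoint ∧
    M = (gates.map czGate).prod

/-- `IsQACCircuit d U`: the operator `U` is of the form `L_d M_d ⋯ L_1 M_1 L_0`, with layers
`L_i` of single-qubit unitaries and layers `M_i` of controlled-`Z` gates. -/
inductive IsQACCircuit {ι : Type} [Fintype ι] [DecidableEq ι] : ℕ → QOp ι → Prop
  | zero (L : QOp ι) (hL : IsLocalLayer L) : IsQACCircuit 0 L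
  | succ (d : ℕ) (L M U : QOp ι) (hL : IsLocalLayer L) (hM : IsCZLayer M)
      (hU : IsQACCircuit d U) : IsQACCircuit (d + 1) (L * M * U)

/-! ### States, channels, Choi operators -/

/-- Density operators: positive semidefinite with trace one. -/
def IsDensity {ι : Type} [Fintype ι] [DecidableEq ι] (ρ : QOp ι) : Prop :=
  ρ.PosSemidef ∧ ρ.trace = 1

/-- `ρ ⊗ ψ`, as a linear map in `ρ`. -/
def tensorState {ι κ : Type} (ψ : QOp κ) : QOp ι →ₗ[ℂ] QOp (ι ⊕ κ) where
  toFun ρ := Matrix.of fun u v =>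
    ρ (fun i => u (Sum.inl i)) (fun i => v (Sum.inl i)) *
      ψ (fun j => u (Sum.inr j)) (fun j => v (Sum.inr j))
  map_add' ρ ρ' := by ext u v; simp [add_mul]
  map_smul' z ρ := by ext u v; simp [mul_assoc]

/-- The partial trace that keeps the qubits `f i` (`f` injective), with `f i` becoming qubit `i`
of the result, and traces out all qubits outside the range of `f`. -/
def partialTrace {ι κ : Type} [Fintype ι] [DecidableEq ι] (f : κ → ι) :
    QOp ι →ₗ[ℂ] QOp κ where
  toFun A := Matrix.of fun s t =>
    open Classical in
    ∑ u : ι → Fin 2, ∑ v : ι → Fin 2,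
      if (∀ i, u (f i) = s i) ∧ (∀ i, v (f i) = t i) ∧ (∀ j, j ∉ Set.range f → u j = v j)
      then A u v else 0
  map_add' A B := by
    ext s t
    simp only [Matrix.of_apply, Matrix.add_apply, ← Finset.sum_add_distrib]
    refine Finset.sum_congr rfl fun u _ => Finset.sum_congr rfl fun v _ => ?_
    split_ifs <;> simp
  map_smul' z A := by
    ext s t
    simp only [Matrix.of_apply, Matrix.smul_apply, smul_eq_mul, Finset.mul_sum,
      RingHom.id_apply, mul_ite, mul_zero]

/-- Conjugation `A ↦ U A U†`. -/
def conjBy {ι : Type} [Fintype ι] [DecidableEq ι] (U : QOp ι) : QOp ι →ₗ[ℂ] QOp ι where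
  toFun A := U * A * U.conjTranspose
  map_add' A B := by simp [mul_add, add_mul]
  map_smul' z A := by simp

/-- The map `ρ ↦ Tr_{[k]ᶜ} (U (ρ ⊗ ψ) U†)` implemented by `U`, which acts on `n` input qubits
followed by `a` ancillae in the state `ψ`, when the first `k ≤ n` qubits are the output. -/
def implementedChannel {n a k : ℕ} (hk : k ≤ n) (U : QOp (Fin n ⊕ Fin a)) (ψ : QOp (Fin a)) :
    QOp (Fin n) →ₗ[ℂ] QOp (Fin k) :=
  partialTrace (fun i : Fin k => (Sum.inl (Fin.castLE hk i) : Fin n ⊕ Fin a)) ∘ₗ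
    conjBy U ∘ₗ tensorState ψ

/-- `(E ⊗ id)(X)`, where the identity acts on a reference system with basis `γ`. -/
def ampliation {m p γ : Type} (E : Matrix m m ℂ →ₗ[ℂ] Matrix p p ℂ)
    (X : Matrix (m × γ) (m × γ) ℂ) : Matrix (p × γ) (p × γ) ℂ :=
  Matrix.of fun s t => E (Matrix.of fun x y => X (x, s.2) (y, t.2)) s.1 t.1

/-- Quantum channels: completely positive trace-preserving linear maps. -/
def IsQuantumChannel {m p : Type} [Fintype m] [DecidableEq m] [Fintype p] [DecidableEq p]
    (E : Matrix m m ℂ →ₗ[ℂ] Matrix p p ℂ) : Prop :=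
  (∀ (r : ℕ) (X : Matrix (m × Fin r) (m × Fin r) ℂ), X.PosSemidef →
    (ampliation E X).PosSemidef) ∧ ∀ A : Matrix m m ℂ, (E A).trace = A.trace

/-- The completely bounded spectral norm: the supremum of `‖(E ⊗ id)(X)‖` over all operators `X`
with `‖X‖ ≤ 1` on the input system and a finite-dimensional reference system. -/
def cbSpectralNorm {m p : Type} [Fintype m] [DecidableEq m] [Fintype p] [DecidableEq p]
    (E : Matrix m m ℂ →ₗ[ℂ] Matrix p p ℂ) : ℝ≥0∞ :=
  ⨆ (r : ℕ) (X : Matrix (m × Fin r) (m × Fin r) ℂ) (_ : ‖X‖ ≤ 1),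
    ENNReal.ofReal ‖ampliation E X‖

/-- The unnormalized maximally entangled operator `∑ x y, |x⟩⟨y| ⊗ |x⟩⟨y|`. -/
def epr (m : Type) [DecidableEq m] : Matrix (m × m) (m × m) ℂ :=
  Matrix.of fun s t => if s.1 = s.2 ∧ t.1 = t.2 then 1 else 0

/-- The Choi operator `(E ⊗ id)(EPR)` of a map from qubits `ι` to qubits `κ`, as an operator on
the qubits `κ ⊕ ι`. -/
def choi {ι κ : Type} [Fintype ι] [DecidableEq ι] (E : QOp ι →ₗ[ℂ] QOp κ) : QOp (κ ⊕ ι) :=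
  Matrix.of fun s t => ampliation E (epr (ι → Fin 2))
    (fun i => s (Sum.inl i), fun j => s (Sum.inr j))
    (fun i => t (Sum.inl i), fun j => t (Sum.inr j))

end

noncomputable section

set_option linter.unusedSectionVars false

/-! ### Tensor products of single-qubit operators and the degree filtration -/

section Degree

variable {ι : Type} [Fintype ι]

/-! The proof works in the Heisenberg picture. Let `V` be `1 ⊗ U`, with `k` reference qubits added,
and let `P` be the projection onto maximally entangled states between the references and the
outputs. By `choi_implementedChannel`, the normalized Choi operator is the image of `V† P V` under a
map that contracts the ancillae with `ψ` and transposes. This map does not raise the degree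
(`sliceTranspose_mem_degLE`) or the spectral norm (`norm_sliceTranspose_le`), so it suffices to
approximate `V† P V`.

The basic tool is a Chebyshev polynomial: the AND of `w` qubits has a uniform approximation with
error `4^(-s)` and degree `O(s √w)` (`exists_degLE_approx_projOnes`). A two-qubit Clifford circuit
on each pair turns `P` into such an AND on `2k` qubits, so `P` has approximate degree `O(s √k)`
(`exists_approx_eprProj`).

Now let `N` be the total number of qubits, and conjugate an operator of degree `l` by one layer of
gates (`exists_approx_czLayer_conj`). Gates of arity at most `t` are kept exactly and multiply the
degree by at most `t`. Larger gates are replaced by their Chebyshev approximations; as the gates are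
disjoint, the product of these has degree `O(s ∑ √|T|) ≤ O(s N / √t)`. Balancing at `t ≈ (N /
l)^(2/3)` gives the recursion `l ↦ O(s N^(2/3) l^(1/3))`. After `d` layers
(`exists_approx_circuit_conj`) the initial degree enters with exponent `3^(-d)` and `N` with
exponent `1 - 3^(-d)`. With `s` of order `log N`, each layer costs an error `O(1 / N)`.

For the second part, `norm_smul_choi_le` shows that a perturbation of size `ε` in the completely
bounded norm moves the normalized Choi operator by at most `ε`, so the same approximant serves.

Degrees are tracked through `degLE`, a filtration by spans of product operators. It is
multiplicative, and only its comparison with the Pauli degree in one direction (`pauliDegree_le`) is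
needed. -/

theorem tensorOp_mul (A B : ι → Matrix (Fin 2) (Fin 2) ℂ) [DecidableEq ι] :
    tensorOp A * tensorOp B = tensorOp fun i => A i * B i := by
  ext x y
  simp only [Matrix.mul_apply, tensorOp, Matrix.of_apply, ← Finset.prod_mul_distrib]
  rw [Finset.prod_univ_sum, Fintype.piFinset_univ]

theorem tensorOp_one [DecidableEq ι] :
    tensorOp (fun _ : ι => (1 : Matrix (Fin 2) (Fin 2) ℂ)) = 1 := by
  ext x y
  simp only [tensorOp, Matrix.of_apply, Matrix.one_apply, funext_iff]
  rw [Finset.prod_ite_zero]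
  simp

theorem tensorOp_conjTranspose (A : ι → Matrix (Fin 2) (Fin 2) ℂ) :
    (tensorOp A).conjTranspose = tensorOp fun i => (A i).conjTranspose := by
  ext x y
  simp [tensorOp, Matrix.conjTranspose_apply]

theorem tensorOp_trace [DecidableEq ι] (A : ι → Matrix (Fin 2) (Fin 2) ℂ) :
    (tensorOp A).trace = ∏ i, (A i).trace := by
  simp only [tensorOp, Matrix.trace, Matrix.diag, Matrix.of_apply]
  rw [Finset.prod_univ_sum, Fintype.piFinset_univ]

/-- The operators that act as the identity outside of `S`. -/
def localOps (S : Finset ι) : Submodule ℂ (QOp ι) :=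
  Submodule.span ℂ {A | ∃ u : ι → Matrix (Fin 2) (Fin 2) ℂ, (∀ i ∉ S, u i = 1) ∧ A = tensorOp u}

/-- The operators of degree at most `l`. -/
def degLE (ι : Type) [Fintype ι] (l : ℕ) : Submodule ℂ (QOp ι) :=
  Submodule.span ℂ {A | ∃ (S : Finset ι) (u : ι → Matrix (Fin 2) (Fin 2) ℂ),
    S.card ≤ l ∧ (∀ i ∉ S, u i = 1) ∧ A = tensorOp u}

theorem tensorOp_mem_localOps {S : Finset ι} {u : ι → Matrix (Fin 2) (Fin 2) ℂ}
    (h : ∀ i ∉ S, u i = 1) : tensorOp u ∈ localOps S :=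
  Submodule.subset_span ⟨u, h, rfl⟩

theorem tensorOp_mem_degLE {S : Finset ι} {u : ι → Matrix (Fin 2) (Fin 2) ℂ} {l : ℕ}
    (hS : S.card ≤ l) (h : ∀ i ∉ S, u i = 1) : tensorOp u ∈ degLE ι l :=
  Submodule.subset_span ⟨S, u, hS, h, rfl⟩

theorem localOps_le_degLE {S : Finset ι} {l : ℕ} (hS : S.card ≤ l) :
    localOps S ≤ degLE ι l := by
  refine Submodule.span_mono ?_
  rintro A ⟨u, h, rfl⟩
  exact ⟨S, u, hS, h, rfl⟩

theorem localOps_mono {S T : Finset ι} (h : S ⊆ T) : localOps S ≤ localOps T := by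
  refine Submodule.span_mono ?_
  rintro A ⟨u, hu, rfl⟩
  exact ⟨u, fun i hi => hu i fun h' => hi (h h'), rfl⟩

theorem degLE_mono {l m : ℕ} (h : l ≤ m) : degLE ι l ≤ degLE ι m := by
  refine Submodule.span_mono ?_
  rintro A ⟨S, u, hS, hu, rfl⟩
  exact ⟨S, u, hS.trans h, hu, rfl⟩

theorem map_mem_of_mem_degLE {M : Type*} [AddCommMonoid M] [Module ℂ M] (f : QOp ι →ₗ[ℂ] M)
    (V : Submodule ℂ M) {l : ℕ}
    (h : ∀ (S : Finset ι) (u : ι → Matrix (Fin 2) (Fin 2) ℂ), S.card ≤ l → (∀ i ∉ S, u i = 1) →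
      f (tensorOp u) ∈ V) {A : QOp ι} (hA : A ∈ degLE ι l) : f A ∈ V := by
  have : degLE ι l ≤ V.comap f := by
    refine Submodule.span_le.2 ?_
    rintro A ⟨S, u, hS, hu, rfl⟩
    exact h S u hS hu
  exact this hA

theorem conjTranspose_mem_degLE {l : ℕ} {A : QOp ι} (hA : A ∈ degLE ι l) :
    A.conjTranspose ∈ degLE ι l := by
  refine Submodule.span_induction (p := fun A _ => A.conjTranspose ∈ degLE ι l) ?_
    (by simp) (fun A B _ _ h h' => ?_) (fun z A _ h => ?_) hA
  · rintro _ ⟨S, u, hS, hu, rfl⟩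
    rw [tensorOp_conjTranspose]
    exact tensorOp_mem_degLE hS fun i hi => by simp [hu i hi]
  · rw [Matrix.conjTranspose_add]; exact Submodule.add_mem _ h h'
  · rw [Matrix.conjTranspose_smul]; exact Submodule.smul_mem _ _ h

variable [DecidableEq ι]

theorem one_mem_localOps (S : Finset ι) : (1 : QOp ι) ∈ localOps S := by
  rw [← tensorOp_one]
  exact tensorOp_mem_localOps fun _ _ => rfl

theorem one_mem_degLE (l : ℕ) : (1 : QOp ι) ∈ degLE ι l :=
  localOps_le_degLE (S := ∅) (by simp) (one_mem_localOps _)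

theorem mul_mem_localOps {S : Finset ι} {A B : QOp ι} (hA : A ∈ localOps S)
    (hB : B ∈ localOps S) : A * B ∈ localOps S := by
  have h := Submodule.mul_mem_mul hA hB
  rw [localOps, Submodule.span_mul_span] at h
  refine Submodule.span_mono ?_ h
  rintro _ ⟨_, ⟨u, hu, rfl⟩, _, ⟨v, hv, rfl⟩, rfl⟩
  exact ⟨_, fun i hi => by simp [hu i hi, hv i hi], tensorOp_mul u v⟩

theorem mul_mem_degLE {l m : ℕ} {A B : QOp ι} (hA : A ∈ degLE ι l) (hB : B ∈ degLE ι m) :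
    A * B ∈ degLE ι (l + m) := by
  have h := Submodule.mul_mem_mul hA hB
  rw [degLE, degLE, Submodule.span_mul_span] at h
  refine Submodule.span_mono ?_ h
  rintro _ ⟨_, ⟨S, u, hS, hu, rfl⟩, _, ⟨T, v, hT, hv, rfl⟩, rfl⟩
  refine ⟨S ∪ T, _, (Finset.card_union_le _ _).trans (add_le_add hS hT), fun i hi => ?_,
    tensorOp_mul u v⟩
  rw [Finset.notMem_union] at hi
  simp [hu i hi.1, hv i hi.2]

theorem pow_mem_degLE {l : ℕ} {A : QOp ι} (hA : A ∈ degLE ι l) (j : ℕ) :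
    A ^ j ∈ degLE ι (j * l) := by
  induction j with
  | zero => simpa using one_mem_degLE _
  | succ j ih => rw [pow_succ, add_mul, one_mul]; exact mul_mem_degLE ih hA

theorem aeval_mem_degLE {l : ℕ} {A : QOp ι} (hA : A ∈ degLE ι l) (p : Polynomial ℂ) :
    Polynomial.aeval A p ∈ degLE ι (p.natDegree * l) := by
  rw [Polynomial.aeval_eq_sum_range]
  refine Submodule.sum_mem _ fun j hj => Submodule.smul_mem _ _ ?_
  refine degLE_mono ?_ (pow_mem_degLE hA j)
  exact Nat.mul_le_mul_right _ (by simpa [Nat.lt_succ_iff] using hj)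

/-- Matrix units are themselves product operators. -/
theorem mem_degLE_card (A : QOp ι) : A ∈ degLE ι (Fintype.card ι) := by
  rw [Matrix.matrix_eq_sum_single A]
  refine Submodule.sum_mem _ fun x _ => Submodule.sum_mem _ fun y _ => ?_
  have : Matrix.single x y (A x y) =
      A x y • tensorOp fun i => Matrix.single (x i) (y i) (1 : ℂ) := by
    ext u v
    simp only [tensorOp, Matrix.smul_apply, Matrix.of_apply, Matrix.single_apply, smul_eq_mul]
    rw [Finset.prod_ite_zero]
    simp [funext_iff, forall_and]
  rw [this]
  exact Submodule.smul_mem _ _ (tensorOp_mem_degLE (S := Finset.univ) le_rfl (by simp))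

theorem localLayer_conj_mem_degLE {L : QOp ι} (hL : IsLocalLayer L) {l : ℕ} {A : QOp ι}
    (hA : A ∈ degLE ι l) : L.conjTranspose * A * L ∈ degLE ι l := by
  obtain ⟨u, hu, rfl⟩ := hL
  refine map_mem_of_mem_degLE
    ((LinearMap.mulLeft ℂ (tensorOp u).conjTranspose).comp (LinearMap.mulRight ℂ (tensorOp u)))
    (degLE ι l) (fun S v hS hv => ?_) hA |> fun h => by simpa [mul_assoc] using h
  simp only [LinearMap.comp_apply, LinearMap.mulLeft_apply, LinearMap.mulRight_apply,
    tensorOp_conjTranspose, tensorOp_mul]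
  refine tensorOp_mem_degLE hS fun i hi => ?_
  rw [hv i hi, one_mul]
  exact (Matrix.mem_unitaryGroup_iff'.1 (hu i))

/-! ### From the filtration to the Pauli degree -/

theorem trace_pauli {a : Fin 4} (ha : a ≠ 0) : (pauli a).trace = 0 := by
  fin_cases a <;> simp_all [pauli, Matrix.trace_fin_two]

/-- The trace of a Pauli string against a product operator factorizes. If the string is heavier than
the support, some factor is the trace of `X`, `Y` or `Z`, which is zero. -/
theorem pauliDegree_le {l : ℕ} {A : QOp ι} (hA : A ∈ degLE ι l) : pauliDegree A ≤ l := by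
  classical
  refine Finset.sup_le fun σ hσ => ?_
  by_contra hl
  refine (Finset.mem_filter.1 hσ).2 ?_
  let f : QOp ι →ₗ[ℂ] ℂ :=
    (Matrix.traceLinearMap (ι → Fin 2) ℂ ℂ).comp
      (LinearMap.mulLeft ℂ (pauliString σ).conjTranspose)
  have h0 : f A ∈ (⊥ : Submodule ℂ ℂ) := by
    refine map_mem_of_mem_degLE f ⊥ (fun S u hS hu => ?_) hA
    have hlt : S.card < (Finset.univ.filter fun i => σ i ≠ 0).card :=
      lt_of_le_of_lt hS (not_le.1 hl)
    obtain ⟨i, hi, hiS⟩ := Finset.exists_mem_notMem_of_card_lt_card hlt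
    have hσi : σ i ≠ 0 := by simpa using hi
    simp only [f, LinearMap.comp_apply, LinearMap.mulLeft_apply, Matrix.traceLinearMap_apply,
      pauliString, tensorOp_conjTranspose, tensorOp_mul, tensorOp_trace, Submodule.mem_bot]
    refine Finset.prod_eq_zero (Finset.mem_univ i) ?_
    rw [hu i hiS, mul_one, Matrix.trace_conjTranspose, trace_pauli hσi, star_zero]
  have h1 : ((pauliString σ).conjTranspose * A).trace = 0 :=
    (Submodule.mem_bot ℂ).1 h0
  simp [pauliCoeff, h1]

theorem approxDegree_le {l : ℕ} {ε : ℝ} {A B : QOp ι} (hB : B ∈ degLE ι l)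
    (hAB : ‖A - B‖ ≤ ε) : approxDegree ε A ≤ l := by
  have h : pauliDegree B ∈ {m : ℕ | ∃ B : QOp ι, ‖A - B‖ ≤ ε ∧ pauliDegree B = m} :=
    ⟨B, hAB, rfl⟩
  exact (Nat.sInf_le h).trans (pauliDegree_le hB)

end Degree

/-! ### Layers of controlled-`Z` gates -/

section Gates

variable {ι : Type} [Fintype ι] [DecidableEq ι]

/-- The projection onto the basis states that are `1` on `S`. -/
def projOnes (S : Finset ι) : QOp ι :=
  Matrix.diagonal fun x => if ∀ i ∈ S, x i = 1 then 1 else 0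

theorem projOnes_eq_tensorOp (S : Finset ι) :
    projOnes S = tensorOp fun i => if i ∈ S then Matrix.diagonal ![0, 1] else 1 := by
  ext x y
  have h : ∀ i, (if i ∈ S then Matrix.diagonal ![(0 : ℂ), 1] else 1) (x i) (y i) =
      if x i = y i ∧ (i ∈ S → x i = 1) then (1 : ℂ) else 0 := by
    intro i
    by_cases hi : i ∈ S <;> simp only [hi, if_true, if_false, true_imp_iff, false_imp_iff]
    · generalize x i = a; generalize y i = b
      fin_cases a <;> fin_cases b <;> simp
    · simp [Matrix.one_apply]
  simp only [projOnes, tensorOp, Matrix.of_apply, h, Matrix.diagonal_apply]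
  rw [Finset.prod_ite_zero]
  by_cases hxy : x = y
  · subst hxy; simp
  · have : ¬ ∀ i ∈ Finset.univ, x i = y i ∧ (i ∈ S → x i = 1) :=
      fun h => hxy (funext fun i => (h i (Finset.mem_univ i)).1)
    rw [if_neg hxy, if_neg this]

theorem czGate_eq (S : Finset ι) : czGate S = 1 - (2 : ℂ) • projOnes S := rfl

theorem projOnes_mem_localOps (S : Finset ι) : projOnes S ∈ localOps S := by
  rw [projOnes_eq_tensorOp]
  exact tensorOp_mem_localOps fun i hi => if_neg hi

theorem czGate_mem_localOps (S : Finset ι) : czGate S ∈ localOps S := by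
  rw [czGate_eq]
  exact Submodule.sub_mem _ (one_mem_localOps S)
    (Submodule.smul_mem _ _ (projOnes_mem_localOps S))

theorem czGate_eq_diagonal (S : Finset ι) :
    czGate S = Matrix.diagonal fun x => if ∀ i ∈ S, x i = 1 then (-1 : ℂ) else 1 := by
  rw [czGate, ← Matrix.diagonal_one, ← Matrix.diagonal_smul, Matrix.diagonal_sub]
  congr 1
  ext x
  simp only [Pi.smul_apply, smul_eq_mul]
  split_ifs <;> norm_num

theorem czGate_commute (S T : Finset ι) : Commute (czGate S) (czGate T) := by
  rw [czGate_eq_diagonal, czGate_eq_diagonal]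
  exact Matrix.commute_diagonal _ _

theorem czGate_conjTranspose (S : Finset ι) : (czGate S).conjTranspose = czGate S := by
  rw [czGate_eq_diagonal, Matrix.diagonal_conjTranspose]
  congr 1
  ext x
  simp only [Pi.star_apply]
  split_ifs <;> simp

theorem czGate_mul_self (S : Finset ι) : czGate S * czGate S = 1 := by
  rw [czGate_eq_diagonal, Matrix.diagonal_mul_diagonal, ← Matrix.diagonal_one]
  congr 1
  ext x
  split_ifs <;> norm_num

theorem tensorOp_commute {u v : ι → Matrix (Fin 2) (Fin 2) ℂ}
    (h : ∀ i, u i = 1 ∨ v i = 1) : Commute (tensorOp u) (tensorOp v) := by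
  rw [commute_iff_eq, tensorOp_mul, tensorOp_mul]
  congr 1
  ext1 i
  rcases h i with h | h <;> simp [h]

theorem projOnes_commute {S T : Finset ι} (hST : Disjoint S T) {A : QOp ι}
    (hA : A ∈ localOps S) : Commute (projOnes T) A := by
  refine Submodule.span_induction (p := fun A _ => Commute (projOnes T) A) ?_
    (Commute.zero_right _) (fun _ _ _ _ h h' => h.add_right h')
    (fun z _ _ h => h.smul_right z) hA
  rintro _ ⟨u, hu, rfl⟩
  rw [projOnes_eq_tensorOp]
  refine tensorOp_commute fun i => ?_
  by_cases hi : i ∈ T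
  · exact Or.inr (hu i (Finset.disjoint_right.1 hST hi))
  · exact Or.inl (if_neg hi)

theorem czGate_commute_of_disjoint {S T : Finset ι} (hST : Disjoint S T) {A : QOp ι}
    (hA : A ∈ localOps S) : Commute (czGate T) A := by
  rw [czGate_eq]
  exact (Commute.one_left A).sub_left ((projOnes_commute hST hA).smul_left 2)

/-- A light-cone argument, peeling off one gate at a time. `S` is the part of the support that later
gates may still meet, and `W` is the part already finished, disjoint from all remaining gates. A
gate that misses `S` commutes with `A` and cancels. A gate that meets `S` moves entirely into `W`:
at least one qubit leaves `S` and at most `t` enter `W`, so `t * S.card + W.card` does not increase.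
-/
theorem czLayer_conj_mem_localOps {t : ℕ} (ht : 1 ≤ t) (gates : List (Finset ι))
    (hd : gates.Pairwise Disjoint) (hc : ∀ T ∈ gates, T.card ≤ t) (S W : Finset ι)
    (hW : ∀ T ∈ gates, Disjoint W T) {A : QOp ι} (hA : A ∈ localOps (S ∪ W)) :
    ∃ R : Finset ι, R.card ≤ t * S.card + W.card ∧
      (gates.map czGate).prod.conjTranspose * A * (gates.map czGate).prod ∈ localOps R := by
  induction gates generalizing S W A with
  | nil =>
    refine ⟨S ∪ W, (Finset.card_union_le _ _).trans ?_, by simpa using hA⟩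
    gcongr
    exact Nat.le_mul_of_pos_left _ ht
  | cons T gates ih =>
    rw [List.pairwise_cons] at hd
    have hc' : ∀ T ∈ gates, T.card ≤ t := fun T' h => hc T' (List.mem_cons_of_mem _ h)
    have hW' : ∀ T ∈ gates, Disjoint W T := fun T' h => hW T' (List.mem_cons_of_mem _ h)
    have key : ((T :: gates).map czGate).prod.conjTranspose * A * ((T :: gates).map czGate).prod
        = (gates.map czGate).prod.conjTranspose * (czGate T * A * czGate T) *
          (gates.map czGate).prod := by
      rw [List.map_cons, List.prod_cons, Matrix.conjTranspose_mul, czGate_conjTranspose]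
      simp only [mul_assoc]
    rw [key]
    by_cases hST : Disjoint S T
    · have hcomm := czGate_commute_of_disjoint
        (Finset.disjoint_union_left.2 ⟨hST, hW T List.mem_cons_self⟩) hA
      rw [hcomm.eq, mul_assoc A, czGate_mul_self, mul_one]
      exact ih hd.2 hc' S W hW' hA
    · have hA' : czGate T * A * czGate T ∈ localOps ((S \ T) ∪ (W ∪ T)) := by
        have hsub : S ∪ W ⊆ (S \ T) ∪ (W ∪ T) := by
          intro i; simp only [Finset.mem_union, Finset.mem_sdiff]; tauto
        have hsub' : T ⊆ (S \ T) ∪ (W ∪ T) := fun i hi => by simp [hi]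
        have hT := localOps_mono hsub' (czGate_mem_localOps T)
        exact mul_mem_localOps (mul_mem_localOps hT (localOps_mono hsub hA)) hT
      obtain ⟨R, hR, hmem⟩ := ih hd.2 hc' (S \ T) (W ∪ T)
        (fun T' h => Finset.disjoint_union_left.2 ⟨hW' T' h, hd.1 T' h⟩) hA'
      refine ⟨R, hR.trans ?_, hmem⟩
      have h1 : (S \ T).card + 1 ≤ S.card := by
        obtain ⟨i, hi, hiT⟩ := Finset.not_disjoint_iff.1 hST
        exact Finset.card_lt_card ⟨Finset.sdiff_subset, fun h => (Finset.mem_sdiff.1 (h hi)).2 hiT⟩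
      have h2 := Finset.card_union_le W T
      have h3 := hc T List.mem_cons_self
      have h4 := Nat.mul_le_mul_left t h1
      rw [mul_add, mul_one] at h4
      omega

theorem czLayer_conj_mem_degLE {t : ℕ} (ht : 1 ≤ t) {gates : List (Finset ι)}
    (hd : gates.Pairwise Disjoint) (hc : ∀ T ∈ gates, T.card ≤ t) {l : ℕ} {A : QOp ι}
    (hA : A ∈ degLE ι l) :
    (gates.map czGate).prod.conjTranspose * A * (gates.map czGate).prod ∈ degLE ι (t * l) := by
  set M := (gates.map czGate).prod with hM
  refine map_mem_of_mem_degLE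
    ((LinearMap.mulLeft ℂ M.conjTranspose).comp (LinearMap.mulRight ℂ M))
    (degLE ι (t * l)) (fun S v hS hv => ?_) hA |> fun h => by simpa [mul_assoc] using h
  obtain ⟨R, hR, hmem⟩ := czLayer_conj_mem_localOps ht gates hd hc S ∅ (by simp)
    (A := tensorOp v) (by simpa using tensorOp_mem_localOps hv)
  refine localOps_le_degLE (hR.trans ?_) (by simpa [mul_assoc] using hmem)
  simpa using Nat.mul_le_mul_left t hS

/-! ### Products of gates: splitting by arity, degrees and errors -/

theorem prod_czGate_eq_filter (gates : List (Finset ι)) (p : Finset ι → Bool) :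
    (gates.map czGate).prod =
      ((gates.filter p).map czGate).prod * ((gates.filter fun T => !p T).map czGate).prod := by
  induction gates with
  | nil => simp
  | cons T gates ih =>
    by_cases h : p T
    · simp [h, ih, mul_assoc]
    · have hc : Commute (czGate T) ((gates.filter p).map czGate).prod := by
        refine Commute.list_prod_right _ _ fun A hA => ?_
        obtain ⟨S, -, rfl⟩ := List.mem_map.1 hA
        exact czGate_commute _ _
      simp only [h, List.map_cons, List.prod_cons, ih, List.filter_cons, if_false, Bool.not_false,
        Bool.false_eq_true, if_true]
      rw [← mul_assoc, hc.eq, mul_assoc]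

theorem sum_card_le_of_pairwise_disjoint {gates : List (Finset ι)}
    (hd : gates.Pairwise Disjoint) : (gates.map Finset.card).sum ≤ Fintype.card ι := by
  have h : ∀ gates : List (Finset ι), gates.Pairwise Disjoint →
      ∃ R : Finset ι, R.card = (gates.map Finset.card).sum ∧
        ∀ T, (∀ S ∈ gates, Disjoint T S) → Disjoint T R := by
    intro gates
    induction gates with
    | nil => exact fun _ => ⟨∅, by simp⟩
    | cons T gates ih =>
      intro hd
      rw [List.pairwise_cons] at hd
      obtain ⟨R, hR, hdis⟩ := ih hd.2
      refine ⟨T ∪ R, ?_, fun T' h => ?_⟩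
      · rw [Finset.card_union_of_disjoint (hdis T hd.1), hR, List.map_cons, List.sum_cons]
      · rw [Finset.disjoint_union_right]
        exact ⟨h T List.mem_cons_self, hdis T' fun S hS => h S (List.mem_cons_of_mem _ hS)⟩
  obtain ⟨R, hR, -⟩ := h gates hd
  rw [← hR]
  exact Finset.card_le_univ R

theorem list_prod_mem_degLE {α : Type*} (l : List α) (g : α → QOp ι) (e : α → ℕ)
    (h : ∀ a ∈ l, g a ∈ degLE ι (e a)) : (l.map g).prod ∈ degLE ι (l.map e).sum := by
  induction l with
  | nil => simpa using one_mem_degLE 0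
  | cons a l ih =>
    simp only [List.map_cons, List.prod_cons, List.sum_cons]
    exact mul_mem_degLE (h a List.mem_cons_self)
      (ih fun b hb => h b (List.mem_cons_of_mem _ hb))

theorem norm_list_prod_le_one {α : Type*} (l : List α) (g : α → QOp ι)
    (h : ∀ a ∈ l, ‖g a‖ ≤ 1) : ‖(l.map g).prod‖ ≤ 1 := by
  induction l with
  | nil => simp
  | cons a l ih =>
    simp only [List.map_cons, List.prod_cons]
    exact (norm_mul_le _ _).trans (mul_le_one₀ (h a List.mem_cons_self) (norm_nonneg _)
      (ih fun b hb => h b (List.mem_cons_of_mem _ hb)))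

theorem norm_mul_sub_mul_le {A B A' B' : QOp ι} (hB : ‖B‖ ≤ 1) (hA' : ‖A'‖ ≤ 1) :
    ‖A * B - A' * B'‖ ≤ ‖A - A'‖ + ‖B - B'‖ := by
  have : A * B - A' * B' = (A - A') * B + A' * (B - B') := by noncomm_ring
  rw [this]
  refine (norm_add_le _ _).trans (add_le_add ?_ ?_)
  · exact (norm_mul_le _ _).trans (mul_le_of_le_one_right (norm_nonneg _) hB)
  · exact (norm_mul_le _ _).trans (mul_le_of_le_one_left (norm_nonneg _) hA')

theorem norm_list_prod_sub_le {α : Type*} (l : List α) (f g : α → QOp ι) (δ : ℝ)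
    (hf : ∀ a ∈ l, ‖f a‖ ≤ 1) (hg : ∀ a ∈ l, ‖g a‖ ≤ 1) (h : ∀ a ∈ l, ‖f a - g a‖ ≤ δ) :
    ‖(l.map f).prod - (l.map g).prod‖ ≤ l.length * δ := by
  induction l with
  | nil => simp
  | cons a l ih =>
    simp only [List.map_cons, List.prod_cons, List.length_cons]
    refine (norm_mul_sub_mul_le (norm_list_prod_le_one l f fun b hb =>
      hf b (List.mem_cons_of_mem _ hb)) (hg a List.mem_cons_self)).trans ?_
    have h1 := h a List.mem_cons_self
    have h2 := ih (fun b hb => hf b (List.mem_cons_of_mem _ hb))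
      (fun b hb => hg b (List.mem_cons_of_mem _ hb)) (fun b hb => h b (List.mem_cons_of_mem _ hb))
    push_cast
    linarith

end Gates

/-! ### Low-degree approximation of controlled gates -/

section ChebyshevApproximation

open Polynomial

/-- The second conjunct, a lower bound on consecutive differences, is what makes the induction
close: the three-term recurrence gives `T_{r+2} - T_{r+1} = (T_{r+1} - T_r) + 2x T_{r+1}` at `1 +
x`. Summing the odd numbers `2r + 1` yields the `r²`. -/
theorem one_add_sq_mul_le_eval_T {x : ℝ} (hx : 0 ≤ x) (r : ℕ) :
    1 + (r : ℝ) ^ 2 * x ≤ (Chebyshev.T ℝ r).eval (1 + x) ∧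
      (Chebyshev.T ℝ r).eval (1 + x) + (2 * r + 1) * x ≤
        (Chebyshev.T ℝ (r + 1 : ℕ)).eval (1 + x) := by
  induction r with
  | zero => simp
  | succ r ih =>
    have h1 : 1 + ((r + 1 : ℕ) : ℝ) ^ 2 * x ≤ (Chebyshev.T ℝ (r + 1 : ℕ)).eval (1 + x) := by
      push_cast at ih ⊢
      linarith [ih.1, ih.2]
    refine ⟨h1, ?_⟩
    have h2 : (Chebyshev.T ℝ (r + 1 + 1 : ℕ)).eval (1 + x) =
        2 * (1 + x) * (Chebyshev.T ℝ (r + 1 : ℕ)).eval (1 + x) -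
          (Chebyshev.T ℝ r).eval (1 + x) := by
      have := Chebyshev.T_add_two ℝ r
      push_cast
      rw [add_assoc, one_add_one_eq_two, this]
      simp
    have h3 : 1 ≤ (Chebyshev.T ℝ (r + 1 : ℕ)).eval (1 + x) :=
      le_trans (le_add_of_nonneg_right (by positivity)) h1
    have h4 := mul_le_mul_of_nonneg_left h3 hx
    rw [h2]
    push_cast at ih h4 ⊢
    nlinarith [ih.2]

/-- The map `y ↦ (y + 1) / w` sends `0, …, w - 1` into `[-1, 1]`, where `T_r` is bounded by `1`, and
sends `w` to `1 + 1/w`, where `T_r` is at least `1 + r²/w ≥ 2`. Normalizing at `w` leaves values of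
size at most `1/2`; the even power `2 * s` makes them nonnegative and at most `4^(-s)`. -/
theorem exists_polynomial_approx_and {w r : ℕ} (s : ℕ) (hw : 1 ≤ w) (hr : w ≤ r ^ 2) :
    ∃ p : ℝ[X], p.natDegree ≤ 2 * s * r ∧ p.eval (w : ℝ) = 1 ∧
      ∀ j : ℕ, j < w → 0 ≤ p.eval (j : ℝ) ∧ p.eval (j : ℝ) ≤ (1 / 4) ^ s := by
  have hw0 : (0 : ℝ) < w := by exact_mod_cast hw
  set c : ℝ := (Chebyshev.T ℝ r).eval (1 + (w : ℝ)⁻¹) with hc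
  have hc2 : 2 ≤ c := by
    have h := (one_add_sq_mul_le_eval_T (inv_nonneg.2 hw0.le) r).1
    have h' : 1 ≤ (r : ℝ) ^ 2 * (w : ℝ)⁻¹ := by
      rw [← div_eq_mul_inv, one_le_div hw0]
      exact_mod_cast hr
    linarith
  set g : ℝ[X] := C c⁻¹ * (Chebyshev.T ℝ r).comp (C (w : ℝ)⁻¹ * X + C (w : ℝ)⁻¹) with hg
  have heval : ∀ y : ℝ, g.eval y = c⁻¹ * (Chebyshev.T ℝ r).eval ((w : ℝ)⁻¹ * y + (w : ℝ)⁻¹) := by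
    intro y; simp [hg]
  refine ⟨g ^ (2 * s), ?_, ?_, fun j hj => ?_⟩
  · refine natDegree_pow_le.trans (Nat.mul_le_mul_left _ ?_)
    refine (natDegree_C_mul_le _ _).trans (natDegree_comp_le.trans ?_)
    rw [Chebyshev.natDegree_T]
    refine (Nat.mul_le_mul_left _ natDegree_linear_le).trans ?_
    simp
  · rw [eval_pow, heval, inv_mul_cancel₀ hw0.ne', ← hc, inv_mul_cancel₀ (by linarith), one_pow]
  · have hj' : (j : ℝ) + 1 ≤ w := by exact_mod_cast hj
    have habs : |(w : ℝ)⁻¹ * j + (w : ℝ)⁻¹| ≤ 1 := by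
      rw [abs_of_nonneg (by positivity), ← mul_add_one, inv_mul_le_iff₀ hw0]
      linarith
    have hT := Chebyshev.abs_eval_T_real_le_one r habs
    have hgle : |g.eval (j : ℝ)| ≤ 1 / 2 := by
      rw [heval, abs_mul, abs_of_nonneg (by positivity)]
      have : c⁻¹ ≤ 1 / 2 := by rw [one_div]; exact inv_anti₀ two_pos hc2
      calc _ ≤ 1 / 2 * 1 := mul_le_mul this hT (abs_nonneg _) (by norm_num)
        _ = 1 / 2 := mul_one _
    have hsq : g.eval (j : ℝ) ^ 2 ≤ 1 / 4 := by
      rw [← sq_abs]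
      nlinarith [abs_nonneg (g.eval (j : ℝ))]
    rw [eval_pow, pow_mul]
    exact ⟨by positivity, pow_le_pow_left₀ (by positivity) hsq s⟩

variable {ι : Type} [Fintype ι] [DecidableEq ι]

theorem sum_projOnes_singleton (T : Finset ι) :
    ∑ i ∈ T, projOnes {i} = Matrix.diagonal fun x : ι → Fin 2 =>
      (((T.filter fun i => x i = 1).card : ℕ) : ℂ) := by
  ext x y
  rw [Matrix.sum_apply]
  by_cases hxy : x = y
  · subst hxy
    simp [projOnes]
  · simp [projOnes, hxy]

theorem aeval_diagonal {m : Type*} [Fintype m] [DecidableEq m] (d : m → ℂ) (p : ℂ[X]) :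
    aeval (Matrix.diagonal d) p = Matrix.diagonal fun x => p.eval (d x) := by
  induction p using Polynomial.induction_on' with
  | add p q hp hq => simp [hp, hq, Matrix.diagonal_add]
  | monomial n a =>
    rw [aeval_monomial, Matrix.diagonal_pow, Matrix.algebraMap_eq_diagonal,
      Matrix.diagonal_mul_diagonal]
    simp

/-- AND depends only on the number of ones in `T`. The operator counting them is a sum of one-qubit
projections, hence of degree `1`, so the univariate polynomial can be evaluated at it. -/
theorem exists_approx_projOnes (T : Finset ι) {r : ℕ} (s : ℕ) (hr : T.card ≤ r ^ 2) :
    ∃ f : (ι → Fin 2) → ℝ,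
      (Matrix.diagonal fun x => (f x : ℂ)) ∈ degLE ι (2 * s * r) ∧
      ∀ x, ((∀ i ∈ T, x i = 1) → f x = 1) ∧
        (¬ (∀ i ∈ T, x i = 1) → 0 ≤ f x ∧ f x ≤ (1 / 4) ^ s) := by
  rcases Nat.eq_zero_or_pos T.card with h0 | hpos
  · refine ⟨fun _ => 1, ?_, fun x => ?_⟩
    · simp [one_mem_degLE (ι := ι)]
    · rw [Finset.card_eq_zero.1 h0]; simp
  · obtain ⟨p, hdeg, hp1, hp⟩ := exists_polynomial_approx_and s hpos hr
    refine ⟨fun x => p.eval ((T.filter fun i => x i = 1).card : ℝ), ?_, fun x => ⟨fun h => ?_,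
      fun h => ?_⟩⟩
    · have hN : ∑ i ∈ T, projOnes {i} ∈ degLE ι 1 :=
        Submodule.sum_mem _ fun i _ => localOps_le_degLE (by simp) (projOnes_mem_localOps {i})
      have h := aeval_mem_degLE hN (p.map Complex.ofRealHom)
      rw [sum_projOnes_singleton, aeval_diagonal] at h
      have heq : (fun x : ι → Fin 2 => (p.map Complex.ofRealHom).eval
          (((T.filter fun i => x i = 1).card : ℕ) : ℂ)) =
          fun x => ((p.eval ((T.filter fun i => x i = 1).card : ℝ) : ℝ) : ℂ) := by
        ext x
        simp
      rw [heq] at h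
      refine degLE_mono ?_ h
      rw [mul_one]
      exact natDegree_map_le.trans hdeg
    · simpa only [Finset.filter_true_of_mem h] using hp1
    · refine hp _ (Finset.card_lt_card ?_)
      rw [Finset.filter_ssubset]
      push Not at h
      exact h

theorem norm_diagonal_ofReal_le (f : (ι → Fin 2) → ℝ) {c : ℝ} (hc : 0 ≤ c)
    (h : ∀ x, |f x| ≤ c) : ‖(Matrix.diagonal fun x => (f x : ℂ) : QOp ι)‖ ≤ c := by
  rw [Matrix.l2_opNorm_diagonal, pi_norm_le_iff_of_nonneg hc]
  intro x
  rw [Complex.norm_real]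
  exact h x

/-- Since the diagonal entries lie in `[0, 1]`, both `Q` and the approximate gate `1 - 2Q` are
contractions. This lets errors add, rather than multiply, in products. -/
theorem exists_degLE_approx_projOnes (T : Finset ι) {r : ℕ} (s : ℕ) (hr : T.card ≤ r ^ 2) :
    ∃ Q ∈ degLE ι (2 * s * r), ‖Q‖ ≤ 1 ∧ ‖1 - (2 : ℂ) • Q‖ ≤ 1 ∧
      ‖projOnes T - Q‖ ≤ (1 / 4) ^ s := by
  obtain ⟨f, hf, h⟩ := exists_approx_projOnes T s hr
  have h4 : ((1 : ℝ) / 4) ^ s ≤ 1 := pow_le_one₀ (by norm_num) (by norm_num)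
  have h01 : ∀ x, 0 ≤ f x ∧ f x ≤ 1 := by
    intro x
    by_cases hx : ∀ i ∈ T, x i = 1
    · rw [(h x).1 hx]; norm_num
    · exact ⟨((h x).2 hx).1, ((h x).2 hx).2.trans h4⟩
  refine ⟨_, hf, norm_diagonal_ofReal_le f zero_le_one fun x => ?_, ?_, ?_⟩
  · rw [abs_of_nonneg (h01 x).1]; exact (h01 x).2
  · have : (1 - (2 : ℂ) • Matrix.diagonal fun x => (f x : ℂ) : QOp ι) =
        Matrix.diagonal fun x => ((1 - 2 * f x : ℝ) : ℂ) := by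
      rw [← Matrix.diagonal_one, ← Matrix.diagonal_smul, Matrix.diagonal_sub]
      congr 1; ext x; simp
    rw [this]
    refine norm_diagonal_ofReal_le _ zero_le_one fun x => abs_le.2 ?_
    constructor <;> linarith [(h01 x).1, (h01 x).2]
  · have : (projOnes T - Matrix.diagonal fun x => (f x : ℂ) : QOp ι) =
        Matrix.diagonal fun x => (((if ∀ i ∈ T, x i = 1 then 1 else 0) - f x : ℝ) : ℂ) := by
      rw [projOnes, Matrix.diagonal_sub]
      congr 1; ext x; push_cast; split_ifs <;> simp
    rw [this]
    refine norm_diagonal_ofReal_le _ (by positivity) fun x => ?_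
    by_cases hx : ∀ i ∈ T, x i = 1
    · rw [if_pos hx, (h x).1 hx]; simp
    · rw [if_neg hx, zero_sub, abs_neg, abs_of_nonneg (h01 x).1]
      exact ((h x).2 hx).2

theorem exists_degLE_approx_czGate (T : Finset ι) {r : ℕ} (s : ℕ) (hr : T.card ≤ r ^ 2) :
    ∃ G ∈ degLE ι (2 * s * r), ‖G‖ ≤ 1 ∧ ‖czGate T - G‖ ≤ 2 * (1 / 4) ^ s := by
  obtain ⟨Q, hQ, -, hG, hTQ⟩ := exists_degLE_approx_projOnes T s hr
  refine ⟨_, Submodule.sub_mem _ (one_mem_degLE _) (Submodule.smul_mem _ 2 hQ), hG, ?_⟩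
  have : czGate T - (1 - (2 : ℂ) • Q) = -((2 : ℂ) • (projOnes T - Q)) := by
    rw [czGate_eq, smul_sub]; abel
  rw [this, norm_neg, norm_smul]
  simpa using hTQ

theorem norm_czGate_le (T : Finset ι) : ‖czGate T‖ ≤ 1 := by
  have : czGate T = Matrix.diagonal fun x => ((if ∀ i ∈ T, x i = 1 then -1 else 1 : ℝ) : ℂ) := by
    rw [czGate_eq_diagonal]; congr 1; ext x; split_ifs <;> simp
  rw [this]
  refine norm_diagonal_ofReal_le _ zero_le_one fun x => ?_
  split_ifs <;> simp

end ChebyshevApproximation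

/-! ### Degree growth under conjugation by a circuit -/

section Circuits

variable {ι : Type} [Fintype ι] [DecidableEq ι]

theorem norm_le_one_of_conjTranspose_mul_self {m n : Type*} [Fintype m] [Fintype n]
    [DecidableEq m] [DecidableEq n] {V : Matrix m n ℂ}
    (h : V.conjTranspose * V = 1) : ‖V‖ ≤ 1 := by
  have h1 := Matrix.l2_opNorm_conjTranspose_mul_self V
  have h2 : ‖(1 : Matrix n n ℂ)‖ ≤ 1 := by
    rw [← Matrix.diagonal_one, Matrix.l2_opNorm_diagonal]
    exact (pi_norm_le_iff_of_nonneg zero_le_one).2 fun x => by simp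
  rw [h] at h1
  nlinarith [norm_nonneg V]

theorem norm_conj_le {m n : Type*} [Fintype m] [Fintype n] [DecidableEq m] [DecidableEq n]
    {V : Matrix m n ℂ} (h : V.conjTranspose * V = 1) (A : Matrix m m ℂ) :
    ‖V.conjTranspose * A * V‖ ≤ ‖A‖ := by
  have hV := norm_le_one_of_conjTranspose_mul_self h
  calc ‖V.conjTranspose * A * V‖ ≤ ‖V.conjTranspose‖ * ‖A‖ * ‖V‖ :=
        (Matrix.l2_opNorm_mul _ _).trans (by gcongr; exact Matrix.l2_opNorm_mul _ _)
    _ ≤ 1 * ‖A‖ * 1 := by gcongr; rwa [Matrix.l2_opNorm_conjTranspose]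
    _ = ‖A‖ := by ring

theorem IsLocalLayer.conjTranspose_mul_self {L : QOp ι} (hL : IsLocalLayer L) :
    L.conjTranspose * L = 1 := by
  obtain ⟨u, hu, rfl⟩ := hL
  rw [tensorOp_conjTranspose, tensorOp_mul, ← tensorOp_one]
  congr 1; ext1 i
  exact Matrix.mem_unitaryGroup_iff'.1 (hu i)

theorem prod_czGate_conjTranspose_mul_self (gates : List (Finset ι)) :
    (gates.map czGate).prod.conjTranspose * (gates.map czGate).prod = 1 := by
  induction gates with
  | nil => simp
  | cons T gates ih =>
    rw [List.map_cons, List.prod_cons, Matrix.conjTranspose_mul, czGate_conjTranspose,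
      mul_assoc, ← mul_assoc (czGate T), czGate_mul_self, one_mul, ih]

theorem IsCZLayer.conjTranspose_mul_self {M : QOp ι} (hM : IsCZLayer M) :
    M.conjTranspose * M = 1 := by
  obtain ⟨gates, -, -, rfl⟩ := hM
  exact prod_czGate_conjTranspose_mul_self gates

theorem conjTranspose_mul_self_mul {A B : QOp ι} (hA : A.conjTranspose * A = 1)
    (hB : B.conjTranspose * B = 1) : (A * B).conjTranspose * (A * B) = 1 := by
  rw [Matrix.conjTranspose_mul, mul_assoc, ← mul_assoc A.conjTranspose, hA, one_mul, hB]

theorem IsQACCircuit.conjTranspose_mul_self {d : ℕ} {U : QOp ι} (hU : IsQACCircuit d U) :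
    U.conjTranspose * U = 1 := by
  induction hU with
  | zero L hL => exact hL.conjTranspose_mul_self
  | succ d L M U hL hM _ ih =>
    exact conjTranspose_mul_self_mul
      (conjTranspose_mul_self_mul hL.conjTranspose_mul_self hM.conjTranspose_mul_self) ih

theorem natCast_list_sum_le {α : Type*} (l : List α) (e f : α → ℕ) (c : ℝ)
    (h : ∀ a ∈ l, (e a : ℝ) ≤ c * f a) : ((l.map e).sum : ℝ) ≤ c * ((l.map f).sum : ℕ) := by
  induction l with
  | nil => simp
  | cons a l ih =>
    have h1 := h a List.mem_cons_self
    have h2 := ih fun b hb => h b (List.mem_cons_of_mem _ hb)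
    simp only [List.map_cons, List.sum_cons, Nat.cast_add]
    linarith

theorem length_le_of_pairwise_disjoint {gates : List (Finset ι)} (hne : ∀ S ∈ gates, S.Nonempty)
    (hd : gates.Pairwise Disjoint) : gates.length ≤ Fintype.card ι := by
  refine le_trans ?_ (sum_card_le_of_pairwise_disjoint hd)
  have := List.length_le_sum_of_one_le (gates.map Finset.card) fun i hi => by
    obtain ⟨S, hS, rfl⟩ := List.mem_map.1 hi
    exact Finset.card_pos.2 (hne S hS)
  simpa using this

/-- Approximating all gates of a layer multiplies the cost by at most the ratio `|T| / √t`. -/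
theorem exists_approx_large_gates {t s : ℕ} (ht : 1 ≤ t) {gates : List (Finset ι)}
    (hne : ∀ S ∈ gates, S.Nonempty) (hd : gates.Pairwise Disjoint)
    (hc : ∀ T ∈ gates, t < T.card) :
    ∃ (e : ℕ) (G : QOp ι), G ∈ degLE ι e ∧ ‖G‖ ≤ 1 ∧
      ‖(gates.map czGate).prod - G‖ ≤ Fintype.card ι * (2 * (1 / 4) ^ s) ∧
      (e : ℝ) ≤ 4 * s / √t * Fintype.card ι := by
  choose g hg hg1 hgc using fun T : Finset ι => exists_degLE_approx_czGate T
    (r := ⌈√(T.card : ℝ)⌉₊) s (by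
      have h := Nat.le_ceil (√(T.card : ℝ))
      have h2 : (T.card : ℝ) ≤ (⌈√(T.card : ℝ)⌉₊ : ℝ) ^ 2 := by
        rw [← Real.sqrt_le_left (by positivity)]; exact h
      exact_mod_cast h2)
  refine ⟨_, (gates.map g).prod, list_prod_mem_degLE gates g _ fun T _ => hg T,
    norm_list_prod_le_one _ _ fun T _ => hg1 T, ?_, ?_⟩
  · refine (norm_list_prod_sub_le gates czGate g _ (fun T _ => norm_czGate_le T)
      (fun T _ => hg1 T) fun T _ => hgc T).trans ?_
    gcongr
    exact length_le_of_pairwise_disjoint hne hd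
  · refine (natCast_list_sum_le gates _ Finset.card (4 * s / √t) fun T hT => ?_).trans ?_
    · have ht0 : 0 < √(t : ℝ) := Real.sqrt_pos.2 (by exact_mod_cast ht)
      have htT : (t : ℝ) ≤ T.card := by exact_mod_cast (hc T hT).le
      have h1 : (1 : ℝ) ≤ √(T.card : ℝ) := by
        rw [Real.one_le_sqrt]
        exact_mod_cast ht.trans (hc T hT).le
      have h2 : (⌈√(T.card : ℝ)⌉₊ : ℝ) ≤ 2 * √(T.card : ℝ) := by
        linarith [Nat.ceil_lt_add_one (Real.sqrt_nonneg (T.card : ℝ))]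
      -- As `|T| > t`, this makes the cost linear in `|T|`, so that disjointness bounds the sum.
      have h3 : √(T.card : ℝ) ≤ T.card / √t := by
        rw [le_div_iff₀ ht0]
        calc √(T.card : ℝ) * √t ≤ √(T.card : ℝ) * √(T.card : ℝ) := by gcongr
          _ = T.card := Real.mul_self_sqrt (Nat.cast_nonneg _)
      push_cast
      calc 2 * (s : ℝ) * ⌈√(T.card : ℝ)⌉₊ ≤ 2 * s * (2 * (T.card / √t)) := by
            gcongr
            linarith
        _ = 4 * s / √t * T.card := by ring
    · gcongr
      exact sum_card_le_of_pairwise_disjoint hd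

theorem norm_conj_sub_conj_le {A M G : QOp ι} (hA : ‖A‖ ≤ 1) (hM : ‖M‖ ≤ 1) (hG : ‖G‖ ≤ 1) :
    ‖M.conjTranspose * A * M - G.conjTranspose * A * G‖ ≤ 2 * ‖M - G‖ := by
  have hMA : ‖G.conjTranspose * A‖ ≤ 1 :=
    (norm_mul_le _ _).trans (mul_le_one₀ (by rwa [Matrix.l2_opNorm_conjTranspose])
      (norm_nonneg _) hA)
  have h1 := norm_mul_sub_mul_le (A := M.conjTranspose * A) (B := M)
    (A' := G.conjTranspose * A) (B' := G) hM hMA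
  have h2 : ‖M.conjTranspose * A - G.conjTranspose * A‖ ≤ ‖M - G‖ := by
    rw [← sub_mul, ← Matrix.conjTranspose_sub]
    refine (norm_mul_le _ _).trans ?_
    rw [Matrix.l2_opNorm_conjTranspose]
    exact mul_le_of_le_one_right (norm_nonneg _) hA
  linarith

/-- Here `u` and `v` stand for the cube roots of `N` and of a bound on the degree, so that the
balanced cost `N^(2/3) l^(1/3)` becomes the monomial `u² v`. -/
theorem exists_approx_czLayer_conj {s : ℕ} (hs : 1 ≤ s) (hN : Fintype.card ι ≤ 2 ^ s)
    {M : QOp ι} (hM : IsCZLayer M) {A : QOp ι} (hA1 : ‖A‖ ≤ 1) {l : ℕ} (hA : A ∈ degLE ι l)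
    {u v : ℝ} (hu : 0 < u) (hv : 0 < v) (huN : u ^ 3 = Fintype.card ι) (hl : (l : ℝ) ≤ v ^ 3) :
    ∃ (l' : ℕ) (B : QOp ι), B ∈ degLE ι l' ∧ ‖B‖ ≤ 1 ∧
      ‖M.conjTranspose * A * M - B‖ ≤ 4 / Fintype.card ι ∧ (l' : ℝ) ≤ 10 * s * (u ^ 2 * v) := by
  have hs' : (1 : ℝ) ≤ s := by exact_mod_cast hs
  have huv : 0 < u ^ 2 * v := by positivity
  -- If `u < v` the trivial degree `N = u³` is already below `u² v`, and nothing needs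
  -- approximating.
  rcases lt_or_ge u v with huv' | hvu
  · refine ⟨Fintype.card ι, M.conjTranspose * A * M, mem_degLE_card _,
      (norm_conj_le hM.conjTranspose_mul_self A).trans hA1, by simp; positivity, ?_⟩
    rw [← huN]
    nlinarith [mul_lt_mul_of_pos_left huv' (pow_pos hu 2)]
  have hM1 := hM.conjTranspose_mul_self
  obtain ⟨gates, hne, hd, rfl⟩ := hM
  -- The threshold that equates the two costs: `t * v³` for small gates and `u³ / √t` for large ones
  -- are then both about `u² v`.
  set t : ℕ := ⌈(u / v) ^ 2⌉₊ with ht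
  have huv1 : 1 ≤ u / v := (one_le_div hv).2 hvu
  have hy1 : 1 ≤ (u / v) ^ 2 := one_le_pow₀ huv1
  have ht1 : 1 ≤ t := Nat.one_le_iff_ne_zero.2 (Nat.ceil_pos.2 (by positivity)).ne'
  have hyt : (u / v) ^ 2 ≤ t := Nat.le_ceil _
  have hty : (t : ℝ) ≤ 2 * (u / v) ^ 2 := by
    linarith [Nat.ceil_lt_add_one (show 0 ≤ (u / v) ^ 2 by positivity)]
  have hsub := List.filter_sublist (p := fun T : Finset ι => decide (T.card ≤ t)) (l := gates)
  have hsub' := List.filter_sublist (p := fun T : Finset ι => !decide (T.card ≤ t)) (l := gates)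
  set small := gates.filter fun T => decide (T.card ≤ t) with hsmall
  set large := gates.filter fun T => !decide (T.card ≤ t) with hlarge
  -- In this order the small gates act on `A` first. Their factor `t` then multiplies only `l`, and
  -- the degree of the approximated large gates is merely added, once on each side.
  have hsplit : (gates.map czGate).prod =
      (small.map czGate).prod * (large.map czGate).prod := prod_czGate_eq_filter gates _
  set A' := (small.map czGate).prod.conjTranspose * A * (small.map czGate).prod with hA'
  have hA'd : A' ∈ degLE ι (t * l) := by
    refine czLayer_conj_mem_degLE ht1 (hd.sublist hsub) (fun T hT => ?_) hA
    simpa using (List.mem_filter.1 hT).2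
  have hA'1 : ‖A'‖ ≤ 1 :=
    (norm_conj_le (prod_czGate_conjTranspose_mul_self small) A).trans hA1
  obtain ⟨e, G, hGd, hG1, hGM, he⟩ := exists_approx_large_gates (s := s) ht1
    (fun S hS => hne S (hsub'.subset hS)) (hd.sublist hsub')
    (fun T hT => by simpa using (List.mem_filter.1 hT).2)
  refine ⟨e + t * l + e, G.conjTranspose * A' * G,
    mul_mem_degLE (mul_mem_degLE (conjTranspose_mem_degLE hGd) hA'd) hGd, ?_, ?_, ?_⟩
  · refine (norm_mul_le _ _).trans (mul_le_one₀ ((norm_mul_le _ _).trans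
      (mul_le_one₀ ?_ (norm_nonneg _) hA'1)) (norm_nonneg _) hG1)
    rwa [Matrix.l2_opNorm_conjTranspose]
  · have hconj : (gates.map czGate).prod.conjTranspose * A * (gates.map czGate).prod =
        (large.map czGate).prod.conjTranspose * A' * (large.map czGate).prod := by
      rw [hsplit, Matrix.conjTranspose_mul, hA']
      simp only [mul_assoc]
    rw [hconj]
    refine (norm_conj_sub_conj_le hA'1 (norm_le_one_of_conjTranspose_mul_self
      (prod_czGate_conjTranspose_mul_self large)) hG1).trans ?_
    have hN0 : (0 : ℝ) < Fintype.card ι := by rw [← huN]; positivity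
    have hN2 : (Fintype.card ι : ℝ) ^ 2 ≤ 4 ^ s := by
      have : (Fintype.card ι : ℝ) ≤ 2 ^ s := by exact_mod_cast hN
      calc (Fintype.card ι : ℝ) ^ 2 ≤ (2 ^ s) ^ 2 := by gcongr
        _ = 4 ^ s := by rw [← pow_mul, mul_comm, pow_mul]; norm_num
    -- Up to `N` gates are replaced, each with error of order `4^(-s) ≤ N^(-2)`.
    have h3 : (Fintype.card ι : ℝ) * (1 / 4) ^ s ≤ 1 / Fintype.card ι := by
      rw [one_div_pow, mul_one_div, div_le_div_iff₀ (by positivity) hN0]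
      nlinarith
    calc _ ≤ 2 * ((Fintype.card ι : ℝ) * (2 * (1 / 4) ^ s)) := by gcongr
      _ = 4 * ((Fintype.card ι : ℝ) * (1 / 4) ^ s) := by ring
      _ ≤ 4 * (1 / Fintype.card ι) := by gcongr
      _ = 4 / Fintype.card ι := by ring
  · have h1 : (t : ℝ) * l ≤ 2 * (u ^ 2 * v) := by
      calc (t : ℝ) * l ≤ 2 * (u / v) ^ 2 * v ^ 3 := by gcongr
        _ = 2 * (u ^ 2 * v) := by field_simp
    have h2 : (e : ℝ) ≤ 4 * s * (u ^ 2 * v) := by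
      refine he.trans ?_
      have h3 : u / v ≤ √t := Real.le_sqrt_of_sq_le hyt
      calc 4 * s / √t * Fintype.card ι ≤ 4 * s / (u / v) * Fintype.card ι := by gcongr
        _ = 4 * s * (u ^ 2 * v) := by rw [← huN]; field_simp
    push_cast
    nlinarith

/-- In the Heisenberg picture the outermost layer acts first, so the induction runs over all `A`,
`l` and `D`, and replaces `D` by `10 s N^(2/3) D^(1/3)`. Conjugation by the remaining circuit is a
contraction, so the layer errors just add up. The exponents are the closed form of this recursion;
that of `10 s` is the partial sum `1 + 1/3 + 1/9 + ⋯`, which stays below `3/2`. -/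
theorem exists_approx_circuit_conj [Nonempty ι] {s : ℕ} (hs : 1 ≤ s)
    (hN : Fintype.card ι ≤ 2 ^ s) {d : ℕ} {U : QOp ι} (hU : IsQACCircuit d U)
    {A : QOp ι} (hA1 : ‖A‖ ≤ 1) {l : ℕ} (hA : A ∈ degLE ι l) {D : ℝ} (hD : 0 < D)
    (hl : (l : ℝ) ≤ D) :
    ∃ (l' : ℕ) (B : QOp ι), B ∈ degLE ι l' ∧ ‖B‖ ≤ 1 ∧
      ‖U.conjTranspose * A * U - B‖ ≤ d * (4 / Fintype.card ι) ∧
      (l' : ℝ) ≤ (10 * s : ℝ) ^ (3 / 2 * (1 - ((3 : ℝ) ^ d)⁻¹)) *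
        (Fintype.card ι : ℝ) ^ (1 - ((3 : ℝ) ^ d)⁻¹) * D ^ ((3 : ℝ) ^ d)⁻¹ := by
  induction hU generalizing A l D with
  | zero L hL =>
    refine ⟨l, L.conjTranspose * A * L, localLayer_conj_mem_degLE hL hA,
      (norm_conj_le hL.conjTranspose_mul_self A).trans hA1, by simp, by simpa using hl⟩
  | succ d L M U hL hM hU ih =>
    have hN0 : (0 : ℝ) < Fintype.card ι := by exact_mod_cast Fintype.card_pos
    have hs0 : (0 : ℝ) < 10 * s := by
      have : (1 : ℝ) ≤ s := by exact_mod_cast hs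
      linarith
    set N : ℝ := (Fintype.card ι : ℝ) with hNdef
    have hcube : ∀ x : ℝ, 0 < x → (x ^ (1 / 3 : ℝ)) ^ 3 = x := fun x hx => by
      rw [← Real.rpow_natCast, ← Real.rpow_mul hx.le]; norm_num
    obtain ⟨l₁, B₁, hB₁, hB₁n, hB₁e, hl₁⟩ := exists_approx_czLayer_conj hs hN hM
      ((norm_conj_le hL.conjTranspose_mul_self A).trans hA1) (localLayer_conj_mem_degLE hL hA)
      (u := N ^ (1 / 3 : ℝ)) (v := D ^ (1 / 3 : ℝ)) (by positivity) (by positivity)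
      (hcube N hN0) (by rwa [hcube D hD])
    obtain ⟨l₂, B₂, hB₂, hB₂n, hB₂e, hl₂⟩ := ih hB₁n hB₁ (by positivity) hl₁
    refine ⟨l₂, B₂, hB₂, hB₂n, ?_, hl₂.trans (le_of_eq ?_)⟩
    · have h1 : (L * M * U).conjTranspose * A * (L * M * U) - B₂ =
          U.conjTranspose * (M.conjTranspose * (L.conjTranspose * A * L) * M - B₁) * U +
            (U.conjTranspose * B₁ * U - B₂) := by
        simp only [Matrix.conjTranspose_mul]; noncomm_ring
      rw [h1]
      have h2 := norm_conj_le hU.conjTranspose_mul_self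
        (M.conjTranspose * (L.conjTranspose * A * L) * M - B₁)
      have h3 := norm_add_le
        (U.conjTranspose * (M.conjTranspose * (L.conjTranspose * A * L) * M - B₁) * U)
        (U.conjTranspose * B₁ * U - B₂)
      push_cast
      linarith
    · set q : ℝ := ((3 : ℝ) ^ d)⁻¹ with hq
      have hq' : ((3 : ℝ) ^ (d + 1))⁻¹ = q / 3 := by rw [pow_succ, mul_inv, hq]; ring
      generalize (10 * (s : ℝ)) = K at hs0 ⊢
      rw [hq', Real.mul_rpow hs0.le (by positivity), Real.mul_rpow (by positivity) (by positivity),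
        ← Real.rpow_natCast, ← Real.rpow_mul hN0.le, ← Real.rpow_mul hN0.le,
        ← Real.rpow_mul hD.le]
      have e1 : K ^ (3 / 2 * (1 - q / 3)) =
          K ^ (3 / 2 * (1 - q)) * K ^ q := by
        rw [← Real.rpow_add hs0]; congr 1; ring
      have e2 : N ^ (1 - q / 3) = N ^ (1 - q) * N ^ (1 / 3 * ((2 : ℕ) : ℝ) * q) := by
        rw [← Real.rpow_add hN0]; congr 1; push_cast; ring
      rw [e1, e2, show q / 3 = 1 / 3 * q by ring]
      ring

end Circuits

/-! ### Approximation of maximally entangled projections -/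

section Entangled

theorem tensorOp_ite_apply {ι : Type} [Fintype ι] [DecidableEq ι] (S : Finset ι)
    (A : Matrix (Fin 2) (Fin 2) ℂ) (x y : ι → Fin 2) :
    tensorOp (fun j => if j ∈ S then A else 1) x y =
      (∏ j ∈ S, A (x j) (y j)) * if ∀ j ∉ S, x j = y j then 1 else 0 := by
  have h : ∀ j, (if j ∈ S then A else 1) (x j) (y j) =
      (if j ∈ S then A (x j) (y j) else 1) * (if j ∉ S → x j = y j then 1 else 0) := by
    intro j
    by_cases hj : j ∈ S <;> simp [hj, Matrix.one_apply]
  simp only [tensorOp, Matrix.of_apply, h, Finset.prod_mul_distrib]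
  rw [Finset.prod_ite_zero, Finset.prod_ite_mem, Finset.univ_inter]
  simp

variable {κ ι : Type} [Fintype κ] [Fintype ι] [DecidableEq κ] [DecidableEq ι]

/-- The projection onto maximally entangled states between the qubits `i : κ` and `o i : ι`. -/
def eprProj (o : κ ↪ ι) : QOp (κ ⊕ ι) :=
  open Classical in
  Matrix.of fun x y => if (∀ i, x (Sum.inl i) = x (Sum.inr (o i))) ∧
    (∀ i, y (Sum.inl i) = y (Sum.inr (o i))) ∧
    (∀ j ∉ Set.range o, x (Sum.inr j) = y (Sum.inr j)) then ((2 : ℂ) ^ Fintype.card κ)⁻¹ else 0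

/-- The qubits `o i`. -/
def outQubits (o : κ ↪ ι) : Finset (κ ⊕ ι) :=
  Finset.univ.map (o.trans Function.Embedding.inr)

/-- The qubits `i` and `o i`. -/
def pairQubits (o : κ ↪ ι) : Finset (κ ⊕ ι) :=
  Finset.univ.map Function.Embedding.inl ∪ outQubits o

/-- The pairs `{i, o i}`. -/
def pairGates (o : κ ↪ ι) : List (Finset (κ ⊕ ι)) :=
  (Finset.univ : Finset κ).toList.map fun i => {Sum.inl i, Sum.inr (o i)}

theorem card_pairQubits (o : κ ↪ ι) : (pairQubits o).card = 2 * Fintype.card κ := by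
  rw [pairQubits, Finset.card_union_of_disjoint, outQubits, Finset.card_map, Finset.card_map,
    Finset.card_univ, two_mul]
  rw [Finset.disjoint_left]
  intro j
  simp only [outQubits, Finset.mem_map, Finset.mem_univ, true_and]
  rintro ⟨i, rfl⟩ ⟨i', h⟩
  cases h

theorem pairGates_pairwise (o : κ ↪ ι) : (pairGates o).Pairwise Disjoint := by
  rw [pairGates, List.pairwise_map]
  refine (Finset.nodup_toList _).imp fun {i j} hij => ?_
  simp [Ne.symm hij]

theorem card_of_mem_pairGates (o : κ ↪ ι) : ∀ T ∈ pairGates o, T.card ≤ 2 := by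
  intro T hT
  obtain ⟨i, -, rfl⟩ := List.mem_map.1 hT
  exact Finset.card_le_two

/-- The sign of a basis state under the controlled-`Z` gates on all pairs. -/
def pairSign (o : κ ↪ ι) (x : κ ⊕ ι → Fin 2) : ℂ :=
  ∏ i, if x (Sum.inl i) = 1 ∧ x (Sum.inr (o i)) = 1 then -1 else 1

theorem prod_czGate_pairGates (o : κ ↪ ι) :
    ((pairGates o).map czGate).prod = Matrix.diagonal (pairSign o) := by
  have h : ∀ l : List κ,
      ((l.map fun i => ({Sum.inl i, Sum.inr (o i)} : Finset (κ ⊕ ι))).map czGate).prod =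
        Matrix.diagonal fun x => (l.map fun i =>
          if x (Sum.inl i) = 1 ∧ x (Sum.inr (o i)) = 1 then (-1 : ℂ) else 1).prod := by
    intro l
    induction l with
    | nil => simp
    | cons i l ih =>
      rw [List.map_cons, List.map_cons, List.prod_cons, ih, czGate_eq_diagonal,
        Matrix.diagonal_mul_diagonal]
      congr 1; ext x
      simp
  rw [pairGates, h]
  congr 1; ext x
  rw [pairSign, Finset.prod_map_toList]

/-- `1 / √2`. -/
def invSqrtTwo : ℂ := ((√2 : ℝ) : ℂ)⁻¹

theorem invSqrtTwo_mul_self : invSqrtTwo * invSqrtTwo = 2⁻¹ := by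
  rw [invSqrtTwo, ← mul_inv, ← Complex.ofReal_mul, Real.mul_self_sqrt (by norm_num)]
  norm_num

theorem star_invSqrtTwo : (starRingEnd ℂ) invSqrtTwo = invSqrtTwo := by
  rw [invSqrtTwo, map_inv₀, Complex.conj_ofReal]

/-- The Hadamard matrix. -/
def hadamard : Matrix (Fin 2) (Fin 2) ℂ :=
  !![invSqrtTwo, invSqrtTwo; invSqrtTwo, -invSqrtTwo]

/-- The unitary that takes the row `⟨1|` to `⟨+|`. -/
def plusRotation : Matrix (Fin 2) (Fin 2) ℂ :=
  !![invSqrtTwo, -invSqrtTwo; invSqrtTwo, invSqrtTwo]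

theorem hadamard_apply (a b : Fin 2) :
    hadamard a b = invSqrtTwo * if a = 1 ∧ b = 1 then -1 else 1 := by
  fin_cases a <;> fin_cases b <;> simp [hadamard]

theorem hadamard_comm (a b : Fin 2) : hadamard a b = hadamard b a := by
  fin_cases a <;> fin_cases b <;> simp [hadamard]

theorem hadamard_conjTranspose : hadamard.conjTranspose = hadamard := by
  ext a b
  fin_cases a <;> fin_cases b <;> simp [hadamard, Matrix.conjTranspose_apply, star_invSqrtTwo]

theorem hadamard_mul_self : hadamard * hadamard = 1 := by
  have h := invSqrtTwo_mul_self
  have h' : (2 : ℂ)⁻¹ + 2⁻¹ = 1 := by norm_num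
  ext a b
  fin_cases a <;> fin_cases b <;> simp [hadamard, Matrix.mul_apply, h, h']

theorem plusRotation_mem : plusRotation ∈ Matrix.unitaryGroup (Fin 2) ℂ := by
  have h := invSqrtTwo_mul_self
  have h' : (2 : ℂ)⁻¹ + 2⁻¹ = 1 := by norm_num
  rw [Matrix.mem_unitaryGroup_iff']
  ext a b
  fin_cases a <;> fin_cases b <;>
    simp [plusRotation, Matrix.mul_apply, Matrix.star_apply, star_invSqrtTwo, h, h']

theorem plusRotation_conj :
    plusRotation.conjTranspose * Matrix.diagonal ![0, 1] * plusRotation =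
      Matrix.of fun _ _ => 2⁻¹ := by
  have h := invSqrtTwo_mul_self
  ext a b
  fin_cases a <;> fin_cases b <;>
    simp [plusRotation, Matrix.mul_apply, Matrix.conjTranspose_apply, star_invSqrtTwo, h]

theorem isLocalLayer_ite {ι : Type} [Fintype ι] [DecidableEq ι] (S : Finset ι)
    {A : Matrix (Fin 2) (Fin 2) ℂ}
    (hA : A ∈ Matrix.unitaryGroup (Fin 2) ℂ) :
    IsLocalLayer (tensorOp fun j : ι => if j ∈ S then A else 1) := by
  refine ⟨_, fun j => ?_, rfl⟩
  split_ifs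
  exacts [hA, one_mem _]

theorem hadamard_mem : hadamard ∈ Matrix.unitaryGroup (Fin 2) ℂ := by
  rw [Matrix.mem_unitaryGroup_iff', Matrix.star_eq_conjTranspose, hadamard_conjTranspose,
    hadamard_mul_self]

/-- The basis state that agrees with `x`, except that qubit `o i` is a copy of qubit `i`. -/
def copyPairs (o : κ ↪ ι) (x : κ ⊕ ι → Fin 2) : κ ⊕ ι → Fin 2 :=
  Sum.elim (x ∘ Sum.inl) (Function.extend o (x ∘ Sum.inl) (x ∘ Sum.inr))

theorem copyPairs_out (o : κ ↪ ι) (x : κ ⊕ ι → Fin 2) (i : κ) :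
    copyPairs o x (Sum.inr (o i)) = x (Sum.inl i) := by
  simp [copyPairs, o.injective.extend_apply]

theorem copyPairs_of_notMem (o : κ ↪ ι) (x : κ ⊕ ι → Fin 2) {j : ι} (hj : j ∉ Set.range o) :
    copyPairs o x (Sum.inr j) = x (Sum.inr j) := by
  simp only [copyPairs, Sum.elim_inr]
  rw [Function.extend_apply' _ _ _ hj]; rfl

theorem forall_notMem_outQubits (o : κ ↪ ι) (p : κ ⊕ ι → Prop) :
    (∀ j ∉ outQubits o, p j) ↔ (∀ i, p (Sum.inl i)) ∧ ∀ j ∉ Set.range o, p (Sum.inr j) := by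
  simp [outQubits, Sum.forall]

theorem forall_notMem_pairQubits (o : κ ↪ ι) (p : κ ⊕ ι → Prop) :
    (∀ j ∉ pairQubits o, p j) ↔ ∀ j ∉ Set.range o, p (Sum.inr j) := by
  simp [pairQubits, outQubits, Sum.forall]

/-- The layer of Hadamard gates on the qubits `o i`. -/
def hadamardLayer (o : κ ↪ ι) : QOp (κ ⊕ ι) :=
  tensorOp fun j => if j ∈ outQubits o then hadamard else 1

theorem hadamardLayer_apply (o : κ ↪ ι) (x y : κ ⊕ ι → Fin 2) :
    hadamardLayer o x y = (∏ i, hadamard (x (Sum.inr (o i))) (y (Sum.inr (o i)))) *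
      if (∀ i, x (Sum.inl i) = y (Sum.inl i)) ∧
        ∀ j ∉ Set.range o, x (Sum.inr j) = y (Sum.inr j) then 1 else 0 := by
  rw [hadamardLayer, tensorOp_ite_apply]
  congr 1
  · rw [outQubits, Finset.prod_map]; rfl
  · exact if_congr (forall_notMem_outQubits o fun j => x j = y j) rfl rfl

theorem hadamardLayer_copyPairs (o : κ ↪ ι) (x : κ ⊕ ι → Fin 2) :
    hadamardLayer o x (copyPairs o x) = invSqrtTwo ^ Fintype.card κ * pairSign o x := by
  have h : (∀ i, x (Sum.inl i) = copyPairs o x (Sum.inl i)) ∧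
      ∀ j ∉ Set.range o, x (Sum.inr j) = copyPairs o x (Sum.inr j) :=
    ⟨fun i => rfl, fun j hj => (copyPairs_of_notMem o x hj).symm⟩
  rw [hadamardLayer_apply, if_pos h, mul_one]
  simp only [copyPairs_out, hadamard_apply, Finset.prod_mul_distrib, Finset.prod_const,
    Finset.card_univ, pairSign]
  simp only [and_comm]

theorem hadamardLayer_symm (o : κ ↪ ι) (x y : κ ⊕ ι → Fin 2) :
    hadamardLayer o x y = hadamardLayer o y x := by
  rw [hadamardLayer_apply, hadamardLayer_apply]
  simp only [hadamard_comm, eq_comm]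

/-- A Hadamard layer changes only the qubits `o i`, and on the support of `eprProj` these are copies
of the references. Hence each matrix-product sum in `hadamardLayer_mul_eprProj_mul` has a single
nonzero term. -/
theorem eq_copyPairs (o : κ ↪ ι) {x u : κ ⊕ ι → Fin 2} (h : hadamardLayer o x u ≠ 0)
    (hu : ∀ i, u (Sum.inl i) = u (Sum.inr (o i))) : u = copyPairs o x := by
  rw [hadamardLayer_apply] at h
  have h' : (∀ i, x (Sum.inl i) = u (Sum.inl i)) ∧
      ∀ j ∉ Set.range o, x (Sum.inr j) = u (Sum.inr j) := by
    by_contra h'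
    rw [if_neg h', mul_zero] at h
    exact h rfl
  ext1 j
  rcases j with i | j
  · exact (h'.1 i).symm
  · by_cases hj : j ∈ Set.range o
    · obtain ⟨i, rfl⟩ := hj
      rw [copyPairs_out, ← hu i, h'.1 i]
    · rw [copyPairs_of_notMem o x hj, h'.2 j hj]

/-- On each pair this is the identity between a Bell state with a Hadamard on one half and a
controlled-`Z` applied to `|++⟩`: both have amplitudes `±1/2`, negative exactly at `11`. -/
theorem hadamardLayer_mul_eprProj_mul (o : κ ↪ ι) :
    hadamardLayer o * eprProj o * hadamardLayer o =
      Matrix.diagonal (pairSign o) *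
        (tensorOp fun j => if j ∈ pairQubits o then Matrix.of fun _ _ => 2⁻¹ else 1) *
        Matrix.diagonal (pairSign o) := by
  classical
  ext x y
  rw [Matrix.mul_diagonal, Matrix.diagonal_mul, tensorOp_ite_apply]
  simp only [Matrix.of_apply, Finset.prod_const, card_pairQubits]
  rw [if_congr (forall_notMem_pairQubits o fun j => x j = y j) rfl rfl]
  rw [Matrix.mul_apply, Finset.sum_eq_single (copyPairs o y)]
  · rw [Matrix.mul_apply, Finset.sum_eq_single (copyPairs o x)]
    · rw [hadamardLayer_copyPairs, hadamardLayer_symm, hadamardLayer_copyPairs]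
      have hP : eprProj o (copyPairs o x) (copyPairs o y) =
          if ∀ j ∉ Set.range o, x (Sum.inr j) = y (Sum.inr j)
          then ((2 : ℂ) ^ Fintype.card κ)⁻¹ else 0 := by
        simp only [eprProj, Matrix.of_apply]
        refine if_congr ?_ rfl rfl
        constructor
        · rintro ⟨-, -, h⟩ j hj
          have := h j hj
          rwa [copyPairs_of_notMem o x hj, copyPairs_of_notMem o y hj] at this
        · intro h
          refine ⟨fun i => (copyPairs_out o x i).symm, fun i => (copyPairs_out o y i).symm,
            fun j hj => ?_⟩
          rw [copyPairs_of_notMem o x hj, copyPairs_of_notMem o y hj, h j hj]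
      rw [hP]
      split_ifs
      · have h2 : invSqrtTwo ^ Fintype.card κ * invSqrtTwo ^ Fintype.card κ =
            ((2 : ℂ) ^ Fintype.card κ)⁻¹ := by
          rw [← mul_pow, invSqrtTwo_mul_self, inv_pow]
        rw [mul_comm 2, pow_mul, pow_two, inv_pow]
        linear_combination ((2 : ℂ) ^ Fintype.card κ)⁻¹ * pairSign o x * pairSign o y * h2
      · simp
    · intro u _ hu
      by_contra hne
      refine hu (eq_copyPairs o (left_ne_zero_of_mul hne) ?_)
      have h := right_ne_zero_of_mul hne
      simp only [eprProj, Matrix.of_apply, ne_eq, ite_eq_right_iff, not_forall] at h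
      exact h.1.1
    · simp
  · intro v _ hv
    by_contra hne
    rw [Matrix.mul_apply, Finset.sum_mul] at hne
    obtain ⟨u, -, hu⟩ := Finset.exists_ne_zero_of_sum_ne_zero hne
    have h1 := right_ne_zero_of_mul hu
    rw [hadamardLayer_symm] at h1
    refine hv (eq_copyPairs o h1 ?_)
    have h := right_ne_zero_of_mul (left_ne_zero_of_mul hu)
    simp only [eprProj, Matrix.of_apply, ne_eq, ite_eq_right_iff, not_forall] at h
    exact h.1.2.1
  · simp

/-- Up to rotations taking `|+⟩⟨+|` to `|1⟩⟨1|`, the projection is a constant-depth conjugate of the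
AND of the `2k` paired qubits. The approximant of that AND is conjugated back by the same circuit.
-/
theorem exists_approx_eprProj (o : κ ↪ ι) (s : ℕ) (hκ : 1 ≤ Fintype.card κ) :
    ∃ (l : ℕ) (B : QOp (κ ⊕ ι)), B ∈ degLE (κ ⊕ ι) l ∧ ‖B‖ ≤ 1 ∧
      ‖eprProj o - B‖ ≤ (1 / 4) ^ s ∧ (l : ℝ) ≤ 10 * s * √(Fintype.card κ) := by
  set k : ℝ := (Fintype.card κ : ℝ) with hk
  have hk1 : 1 ≤ k := by rw [hk]; exact_mod_cast hκ
  obtain ⟨Q, hQ, hQ1, -, hQe⟩ := exists_degLE_approx_projOnes (pairQubits o)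
    (r := ⌈√(2 * k)⌉₊) s (by
      have h := Nat.le_ceil √(2 * k)
      have h2 : 2 * k ≤ (⌈√(2 * k)⌉₊ : ℝ) ^ 2 := by
        rw [← Real.sqrt_le_left (by positivity)]; exact h
      rw [card_pairQubits, ← Nat.cast_le (α := ℝ)]
      push_cast
      exact h2)
  set R : QOp (κ ⊕ ι) := tensorOp fun j => if j ∈ pairQubits o then plusRotation else 1 with hR
  set M : QOp (κ ⊕ ι) := ((pairGates o).map czGate).prod with hM
  set H := hadamardLayer o with hH
  have hRl : IsLocalLayer R := isLocalLayer_ite _ plusRotation_mem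
  have hHl : IsLocalLayer H := isLocalLayer_ite _ hadamard_mem
  have hMM := prod_czGate_conjTranspose_mul_self (pairGates o)
  have hHH : H * H = 1 := by
    rw [hH, hadamardLayer, tensorOp_mul, ← tensorOp_one]
    congr 1; ext1 j
    split_ifs
    exacts [hadamard_mul_self, one_mul 1]
  have hHc : H.conjTranspose = H := by
    rw [hH, hadamardLayer, tensorOp_conjTranspose]
    congr 1; ext1 j
    split_ifs
    exacts [hadamard_conjTranspose, Matrix.conjTranspose_one]
  have hMc : M.conjTranspose = M := by
    rw [hM, prod_czGate_pairGates, Matrix.diagonal_conjTranspose]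
    congr 1; ext x
    simp only [Pi.star_apply, pairSign, star_prod]
    refine Finset.prod_congr rfl fun i _ => ?_
    split_ifs <;> simp
  have hT : R.conjTranspose * projOnes (pairQubits o) * R =
      tensorOp fun j => if j ∈ pairQubits o then Matrix.of fun _ _ => 2⁻¹ else 1 := by
    rw [projOnes_eq_tensorOp, hR, tensorOp_conjTranspose, tensorOp_mul, tensorOp_mul]
    congr 1; ext1 j
    split_ifs
    · exact plusRotation_conj
    · simp
  have hP : eprProj o = (R * M * H).conjTranspose * projOnes (pairQubits o) * (R * M * H) := by
    have h1 := hadamardLayer_mul_eprProj_mul o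
    rw [← hT, ← prod_czGate_pairGates, ← hM, ← hH] at h1
    calc eprProj o = (H * H) * eprProj o * (H * H) := by rw [hHH, one_mul, mul_one]
      _ = H * (H * eprProj o * H) * H := by simp only [mul_assoc]
      _ = _ := by
        rw [h1]
        simp only [Matrix.conjTranspose_mul, hMc, hHc, mul_assoc]
  have hC : (R * M * H).conjTranspose * (R * M * H) = 1 :=
    conjTranspose_mul_self_mul (conjTranspose_mul_self_mul hRl.conjTranspose_mul_self hMM)
      hHl.conjTranspose_mul_self
  -- The leading `2` is the arity of the pair gates; the single-qubit layers leave the degree alone.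
  refine ⟨2 * (2 * s * ⌈√(2 * k)⌉₊), (R * M * H).conjTranspose * Q * (R * M * H), ?_,
    (norm_conj_le hC Q).trans hQ1, ?_, ?_⟩
  · have h := localLayer_conj_mem_degLE hHl (czLayer_conj_mem_degLE one_le_two
      (pairGates_pairwise o) (card_of_mem_pairGates o) (localLayer_conj_mem_degLE hRl hQ))
    rw [← hM] at h
    simpa only [Matrix.conjTranspose_mul, mul_assoc] using h
  · rw [hP, ← sub_mul, ← mul_sub]
    exact (norm_conj_le hC _).trans hQe
  -- The bounds `√2 ≤ 3/2` and `1 ≤ √k` absorb the ceiling into a constant.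
  · have h1 : √(2 * k) ≤ 3 / 2 * √k := by
      rw [Real.sqrt_mul (by norm_num)]
      gcongr
      rw [Real.sqrt_le_left (by norm_num)]
      norm_num
    have h2 : 1 ≤ √k := Real.one_le_sqrt.2 hk1
    have h3 : (⌈√(2 * k)⌉₊ : ℝ) ≤ 5 / 2 * √k := by
      linarith [Nat.ceil_lt_add_one (Real.sqrt_nonneg (2 * k))]
    push_cast
    calc 2 * (2 * (s : ℝ) * ⌈√(2 * k)⌉₊) ≤ 2 * (2 * s * (5 / 2 * √k)) := by gcongr
      _ = 10 * s * √k := by ring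

end Entangled

/-! ### Bilinear bounds for the spectral norm -/

section Bilinear

open Matrix

variable {m n : Type*} [Fintype m] [Fintype n] [DecidableEq m] [DecidableEq n]

omit [DecidableEq m] in
theorem norm_toLp_star (u : m → ℂ) :
    ‖(WithLp.toLp 2 (star u) : EuclideanSpace ℂ m)‖ = ‖(WithLp.toLp 2 u : EuclideanSpace ℂ m)‖ := by
  simp [EuclideanSpace.norm_eq]

omit [DecidableEq m] in
theorem norm_dotProduct_le (u v : m → ℂ) :
    ‖u ⬝ᵥ v‖ ≤ ‖(WithLp.toLp 2 u : EuclideanSpace ℂ m)‖ *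
      ‖(WithLp.toLp 2 v : EuclideanSpace ℂ m)‖ := by
  have h := norm_inner_le_norm (𝕜 := ℂ) (WithLp.toLp 2 (star u) : EuclideanSpace ℂ m)
    (WithLp.toLp 2 v)
  rw [norm_toLp_star, EuclideanSpace.inner_toLp_toLp, star_star, dotProduct_comm] at h
  exact h

omit [DecidableEq m] in
theorem norm_bilin_le (A : Matrix m n ℂ) (u : m → ℂ) (v : n → ℂ) :
    ‖u ⬝ᵥ A *ᵥ v‖ ≤ ‖A‖ * ‖(WithLp.toLp 2 u : EuclideanSpace ℂ m)‖ *
      ‖(WithLp.toLp 2 v : EuclideanSpace ℂ n)‖ := by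
  have h := Matrix.l2_opNorm_mulVec A (WithLp.toLp 2 v)
  calc _ ≤ _ := norm_dotProduct_le u (A *ᵥ v)
    _ ≤ ‖(WithLp.toLp 2 u : EuclideanSpace ℂ m)‖ *
        (‖A‖ * ‖(WithLp.toLp 2 v : EuclideanSpace ℂ n)‖) := by gcongr; exact h
    _ = _ := by ring

/-- Testing with `u` the complex conjugate of `A v` gives `‖A v‖²` on the left. -/
theorem l2_opNorm_le_of_bilin {A : Matrix m n ℂ} {c : ℝ} (hc : 0 ≤ c)
    (h : ∀ (u : m → ℂ) (v : n → ℂ), ‖u ⬝ᵥ A *ᵥ v‖ ≤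
      c * ‖(WithLp.toLp 2 u : EuclideanSpace ℂ m)‖ * ‖(WithLp.toLp 2 v : EuclideanSpace ℂ n)‖) :
    ‖A‖ ≤ c := by
  rw [Matrix.l2_opNorm_def]
  refine ContinuousLinearMap.opNorm_le_bound _ hc fun x => ?_
  set y : EuclideanSpace ℂ m := WithLp.toLp 2 (A *ᵥ x.ofLp) with hy
  change ‖y‖ ≤ c * ‖x‖
  have h1 := h (star (A *ᵥ x.ofLp)) x.ofLp
  rw [norm_toLp_star] at h1
  have h2 : ‖star (A *ᵥ x.ofLp) ⬝ᵥ A *ᵥ x.ofLp‖ = ‖y‖ * ‖y‖ := by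
    have h3 : star (A *ᵥ x.ofLp) ⬝ᵥ A *ᵥ x.ofLp = inner ℂ y y := by
      rw [hy, EuclideanSpace.inner_toLp_toLp, dotProduct_comm]
    rw [h3, inner_self_eq_norm_sq_to_K, norm_pow, RCLike.norm_ofReal, abs_norm, sq]
  rw [h2] at h1
  rcases (norm_nonneg y).eq_or_lt with h0 | hpos
  · rw [← h0]; positivity
  · refine le_of_mul_le_mul_right ?_ hpos
    calc ‖y‖ * ‖y‖ ≤ c * ‖y‖ * ‖x‖ := h1
      _ = c * ‖x‖ * ‖y‖ := by ring

end Bilinear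

/-! ### The Choi operator in the Heisenberg picture -/

section Heisenberg

open Matrix

variable {κ ι α : Type} [Fintype κ] [Fintype ι] [Fintype α] [DecidableEq κ] [DecidableEq ι]
  [DecidableEq α]

theorem sum_sumElim {M : Type*} [AddCommMonoid M] (f : (ι ⊕ α → Fin 2) → M) :
    ∑ x, f x = ∑ p : ι → Fin 2, ∑ z : α → Fin 2, f (Sum.elim p z) := by
  rw [← (Equiv.sumArrowEquivProdArrow ι α (Fin 2)).symm.sum_comp, Fintype.sum_prod_type]
  rfl

/-- The operator `1 ⊗ U`. -/
def extendOp (κ : Type) [Fintype κ] [DecidableEq κ] (U : QOp ι) : QOp (κ ⊕ ι) :=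
  (Matrix.kronecker (1 : QOp κ) U).submatrix (Equiv.sumArrowEquivProdArrow κ ι (Fin 2))
    (Equiv.sumArrowEquivProdArrow κ ι (Fin 2))

theorem extendOp_apply (U : QOp ι) (x y : κ ⊕ ι → Fin 2) :
    extendOp κ U x y =
      (if x ∘ Sum.inl = y ∘ Sum.inl then 1 else 0) * U (x ∘ Sum.inr) (y ∘ Sum.inr) := by
  simp [extendOp, Equiv.sumArrowEquivProdArrow, Matrix.one_apply]

theorem extendOp_mul (A B : QOp ι) : extendOp κ (A * B) = extendOp κ A * extendOp κ B := by
  rw [extendOp, extendOp, extendOp, Matrix.submatrix_mul_equiv]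
  congr 1
  have := Matrix.mul_kronecker_mul (1 : QOp κ) (1 : QOp κ) A B
  rwa [one_mul] at this

theorem extendOp_one : extendOp κ (1 : QOp ι) = 1 := by
  rw [extendOp, Matrix.kronecker, Matrix.one_kronecker_one, Matrix.submatrix_one_equiv]

theorem extendOp_tensorOp (u : ι → Matrix (Fin 2) (Fin 2) ℂ) :
    extendOp κ (tensorOp u) = tensorOp (Sum.elim (fun _ => 1) u) := by
  ext x y
  have h : (∏ i : κ, (1 : Matrix (Fin 2) (Fin 2) ℂ) (x (Sum.inl i)) (y (Sum.inl i))) =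
      if x ∘ Sum.inl = y ∘ Sum.inl then 1 else 0 := by
    have := congrFun₂ (tensorOp_one (ι := κ)) (x ∘ Sum.inl) (y ∘ Sum.inl)
    rwa [Matrix.one_apply] at this
  rw [extendOp_apply]
  simp only [tensorOp, Matrix.of_apply, Fintype.prod_sum_type, Sum.elim_inl, Sum.elim_inr, h,
    Function.comp_apply]

theorem extendOp_czGate (S : Finset ι) :
    extendOp κ (czGate S) = czGate (S.map Function.Embedding.inr) := by
  have h : extendOp κ (projOnes S) = projOnes (S.map Function.Embedding.inr) := by
    rw [projOnes_eq_tensorOp, projOnes_eq_tensorOp, extendOp_tensorOp]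
    congr 1
    ext1 j
    rcases j with i | j <;> simp
  rw [czGate_eq, czGate_eq, ← h, ← extendOp_one]
  ext x y
  simp only [extendOp_apply, Matrix.sub_apply, Matrix.smul_apply, smul_eq_mul]
  ring

theorem IsLocalLayer.extendOp {L : QOp ι} (hL : IsLocalLayer L) :
    IsLocalLayer (extendOp κ L) := by
  obtain ⟨u, hu, rfl⟩ := hL
  refine ⟨_, fun j => ?_, extendOp_tensorOp u⟩
  rcases j with i | j
  · exact one_mem _
  · exact hu j

theorem IsCZLayer.extendOp {M : QOp ι} (hM : IsCZLayer M) : IsCZLayer (extendOp κ M) := by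
  obtain ⟨gates, hne, hd, rfl⟩ := hM
  refine ⟨gates.map fun S => S.map Function.Embedding.inr, ?_, ?_, ?_⟩
  · intro S hS
    obtain ⟨T, hT, rfl⟩ := List.mem_map.1 hS
    exact (hne T hT).map
  · rw [List.pairwise_map]
    exact hd.imp fun h => (Finset.disjoint_map _).2 h
  · clear hne hd
    induction gates with
    | nil => simp [extendOp_one]
    | cons T gates ih => simp [extendOp_mul, ih, extendOp_czGate]

theorem IsQACCircuit.extendOp {d : ℕ} {U : QOp ι} (hU : IsQACCircuit d U) :
    IsQACCircuit d (extendOp κ U) := by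
  induction hU with
  | zero L hL => exact .zero _ hL.extendOp
  | succ d L M U hL hM _ ih =>
    rw [extendOp_mul, extendOp_mul]
    exact .succ d _ _ _ hL.extendOp hM.extendOp ih

theorem extendOp_conj_apply (U : QOp ι) (P : QOp (κ ⊕ ι)) (p q : κ → Fin 2) (x y : ι → Fin 2) :
    ((extendOp κ U).conjTranspose * P * extendOp κ U) (Sum.elim p x) (Sum.elim q y) =
      ∑ u, ∑ v, P (Sum.elim p v) (Sum.elim q u) * (U u y * star (U v x)) := by
  have h : ∀ (p q : κ → Fin 2) (x y : ι → Fin 2),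
      extendOp κ U (Sum.elim p x) (Sum.elim q y) = if p = q then U x y else 0 := by
    intro p q x y
    rw [extendOp_apply, Sum.elim_comp_inl, Sum.elim_comp_inl, ite_mul, one_mul, zero_mul]
    rfl
  simp only [Matrix.mul_apply, sum_sumElim, Matrix.conjTranspose_apply]
  simp only [h]
  rw [Finset.sum_eq_single q (fun r _ hr => by simp [hr]) (by simp)]
  refine Finset.sum_congr rfl fun u _ => ?_
  rw [if_pos rfl, Finset.sum_eq_single p (fun r _ hr => by simp [hr]) (by simp), Finset.sum_mul]
  refine Finset.sum_congr rfl fun v _ => ?_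
  rw [if_pos rfl]
  ring

/-- Joins basis states of the registers `κ ⊕ ι` and `α`. -/
def glue (s : κ ⊕ ι → Fin 2) (z : α → Fin 2) : κ ⊕ (ι ⊕ α) → Fin 2 :=
  Sum.elim (s ∘ Sum.inl) (Sum.elim (s ∘ Sum.inr) z)

theorem sum_glue {M : Type*} [AddCommMonoid M] (f : (κ ⊕ (ι ⊕ α) → Fin 2) → M) :
    ∑ x, f x = ∑ s : κ ⊕ ι → Fin 2, ∑ z : α → Fin 2, f (glue s z) := by
  simp only [sum_sumElim, glue, Sum.elim_comp_inl, Sum.elim_comp_inr]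

/-- The transpose of the partial trace of `X (1 ⊗ ψ)` over the register `α`. -/
def sliceTranspose (ψ : QOp α) : QOp (κ ⊕ (ι ⊕ α)) →ₗ[ℂ] QOp (κ ⊕ ι) where
  toFun X := Matrix.of fun s t => ∑ z, ∑ z', X (glue t z') (glue s z) * ψ z z'
  map_add' X Y := by ext s t; simp [add_mul, Finset.sum_add_distrib]
  map_smul' c X := by ext s t; simp [Finset.mul_sum, mul_assoc]

theorem sliceTranspose_apply (ψ : QOp α) (X : QOp (κ ⊕ (ι ⊕ α))) (s t : κ ⊕ ι → Fin 2) :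
    sliceTranspose ψ X s t = ∑ z, ∑ z', X (glue t z') (glue s z) * ψ z z' := rfl

/-- On a product operator, the factors on `α` contract with `ψ` to a scalar, and the other factors
are transposed one by one, so the support can only shrink. -/
theorem sliceTranspose_mem_degLE (ψ : QOp α) {l : ℕ} {X : QOp (κ ⊕ (ι ⊕ α))}
    (hX : X ∈ degLE (κ ⊕ (ι ⊕ α)) l) : sliceTranspose ψ X ∈ degLE (κ ⊕ ι) l := by
  refine map_mem_of_mem_degLE (sliceTranspose ψ) _ (fun S u hS hu => ?_) hX
  let g : κ ⊕ ι → κ ⊕ (ι ⊕ α) := Sum.map id Sum.inl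
  have hg : Function.Injective g := Function.injective_id.sumMap Sum.inl_injective
  have h : sliceTranspose ψ (tensorOp u) =
      (∑ z, ∑ z', (∏ j : α, u (Sum.inr (Sum.inr j)) (z' j) (z j)) * ψ z z') •
        tensorOp fun j => (u (g j)).transpose := by
    ext s t
    rw [sliceTranspose_apply, Matrix.smul_apply, smul_eq_mul, Finset.sum_mul]
    refine Finset.sum_congr rfl fun z _ => ?_
    rw [Finset.sum_mul]
    refine Finset.sum_congr rfl fun z' _ => ?_
    simp only [tensorOp, Matrix.of_apply, Fintype.prod_sum_type, glue, Sum.elim_inl, Sum.elim_inr,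
      Function.comp_apply, Matrix.transpose_apply, g, Sum.map_inl, Sum.map_inr, id]
    ring
  rw [h]
  refine Submodule.smul_mem _ _ (tensorOp_mem_degLE (S := Finset.univ.filter fun j => g j ∈ S)
    ((Finset.card_le_card_of_injOn g (by intro j; simp) hg.injOn).trans hS) fun j hj => ?_)
  rw [hu (g j) (by simpa using hj), Matrix.transpose_one]

theorem norm_glue_mul (v : (κ ⊕ ι → Fin 2) → ℂ) (b : (α → Fin 2) → ℂ)
    (w : (κ ⊕ (ι ⊕ α) → Fin 2) → ℂ) (hw : ∀ s z, w (glue s z) = v s * b z) :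
    ‖(WithLp.toLp 2 w : EuclideanSpace ℂ _)‖ =
      ‖(WithLp.toLp 2 v : EuclideanSpace ℂ _)‖ * ‖(WithLp.toLp 2 b : EuclideanSpace ℂ _)‖ := by
  rw [EuclideanSpace.norm_eq, EuclideanSpace.norm_eq, EuclideanSpace.norm_eq,
    ← Real.sqrt_mul (Finset.sum_nonneg fun _ _ => by positivity), sum_glue, Finset.sum_mul_sum]
  simp only [hw, norm_mul, mul_pow]

open scoped MatrixOrder in
theorem exists_eq_conjTranspose_mul_self {m : Type*} [Fintype m] [DecidableEq m]
    {A : Matrix m m ℂ} (hA : A.PosSemidef) : ∃ B : Matrix m m ℂ, A = B.conjTranspose * B :=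
  CStarAlgebra.nonneg_iff_eq_star_mul_self.1 hA.nonneg

/-- Writing `ψ = B† B` with rows `B l` decomposes the bilinear form of the slice at `u`, `v` into
forms of `X` at the product vectors `v ⊗ B l` and `u ⊗ conj (B l)`. Their norms contribute the
weights `‖B l‖²`, which sum to `tr ψ = 1`. -/
theorem norm_sliceTranspose_le {ψ : QOp α} (hψ : IsDensity ψ) (X : QOp (κ ⊕ (ι ⊕ α))) :
    ‖sliceTranspose ψ X‖ ≤ ‖X‖ := by
  obtain ⟨hpos, htr⟩ := hψ
  obtain ⟨B, rfl⟩ := exists_eq_conjTranspose_mul_self hpos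
  have hB : ∑ l, ‖(WithLp.toLp 2 (B l) : EuclideanSpace ℂ _)‖ ^ 2 = 1 := by
    have h : ((∑ l, ‖(WithLp.toLp 2 (B l) : EuclideanSpace ℂ _)‖ ^ 2 : ℝ) : ℂ) = 1 := by
      rw [← htr, Matrix.trace, Complex.ofReal_sum]
      simp only [EuclideanSpace.norm_sq_eq, Complex.ofReal_sum, Matrix.diag, Matrix.mul_apply,
        Matrix.conjTranspose_apply]
      rw [Finset.sum_comm]
      refine Finset.sum_congr rfl fun z _ => Finset.sum_congr rfl fun l _ => ?_
      rw [Complex.star_def, ← Complex.normSq_eq_conj_mul_self, Complex.normSq_eq_norm_sq]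
    exact_mod_cast h
  refine l2_opNorm_le_of_bilin (norm_nonneg X) fun u v => ?_
  let a : (α → Fin 2) → (κ ⊕ (ι ⊕ α) → Fin 2) → ℂ := fun l x =>
    v (Sum.elim (x ∘ Sum.inl) (x ∘ Sum.inr ∘ Sum.inl)) * B l (x ∘ Sum.inr ∘ Sum.inr)
  let b : (α → Fin 2) → (κ ⊕ (ι ⊕ α) → Fin 2) → ℂ := fun l x =>
    u (Sum.elim (x ∘ Sum.inl) (x ∘ Sum.inr ∘ Sum.inl)) * star (B l) (x ∘ Sum.inr ∘ Sum.inr)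
  have hglue : ∀ (s : κ ⊕ ι → Fin 2) (z : α → Fin 2),
      Sum.elim (glue s z ∘ Sum.inl) (glue s z ∘ Sum.inr ∘ Sum.inl) = s ∧
        glue s z ∘ Sum.inr ∘ Sum.inr = z := by
    intro s z
    refine ⟨?_, rfl⟩
    ext1 j
    rcases j with j | j <;> rfl
  have ha : ∀ l s z, a l (glue s z) = v s * B l z := fun l s z => by
    simp only [a, (hglue s z).1, (hglue s z).2]
  have hb : ∀ l s z, b l (glue s z) = u s * star (B l) z := fun l s z => by
    simp only [b, (hglue s z).1, (hglue s z).2]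
  have key : u ⬝ᵥ sliceTranspose (B.conjTranspose * B) X *ᵥ v = ∑ l, a l ⬝ᵥ X *ᵥ b l := by
    simp only [dotProduct, mulVec, sliceTranspose_apply, sum_glue, ha, hb, Matrix.mul_apply,
      Matrix.conjTranspose_apply, Finset.mul_sum, Finset.sum_mul, Pi.star_apply]
    have h1 : ∀ F : (κ ⊕ ι → Fin 2) → (κ ⊕ ι → Fin 2) → (α → Fin 2) → (α → Fin 2) →
        (α → Fin 2) → ℂ, ∑ s, ∑ t, ∑ z, ∑ z', ∑ l, F s t z z' l =
          ∑ l, ∑ t, ∑ z', ∑ s, ∑ z, F s t z z' l := by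
      intro F
      calc _ = ∑ s, ∑ t, ∑ l, ∑ z', ∑ z, F s t z z' l := by
            refine Finset.sum_congr rfl fun s _ => Finset.sum_congr rfl fun t _ => ?_
            rw [Finset.sum_comm]
            simp_rw [Finset.sum_comm (s := (Finset.univ : Finset (α → Fin 2)))
              (t := (Finset.univ : Finset (α → Fin 2))) (f := fun z l => F s t z _ l)]
            rw [Finset.sum_comm]
        _ = ∑ s, ∑ l, ∑ t, ∑ z', ∑ z, F s t z z' l :=
            Finset.sum_congr rfl fun s _ => Finset.sum_comm
        _ = ∑ l, ∑ s, ∑ t, ∑ z', ∑ z, F s t z z' l := Finset.sum_comm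
        _ = ∑ l, ∑ t, ∑ s, ∑ z', ∑ z, F s t z z' l :=
            Finset.sum_congr rfl fun l _ => Finset.sum_comm
        _ = _ := Finset.sum_congr rfl fun l _ => Finset.sum_congr rfl fun t _ => Finset.sum_comm
    rw [h1]
    refine Finset.sum_congr rfl fun l _ => Finset.sum_congr rfl fun t _ =>
      Finset.sum_congr rfl fun z' _ => Finset.sum_congr rfl fun s _ =>
        Finset.sum_congr rfl fun z _ => ?_
    ring
  rw [key]
  refine (norm_sum_le _ _).trans ?_
  calc ∑ l, ‖a l ⬝ᵥ X *ᵥ b l‖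
      ≤ ∑ l, ‖X‖ * ‖(WithLp.toLp 2 u : EuclideanSpace ℂ _)‖ *
        ‖(WithLp.toLp 2 v : EuclideanSpace ℂ _)‖ *
          ‖(WithLp.toLp 2 (B l) : EuclideanSpace ℂ _)‖ ^ 2 := by
        refine Finset.sum_le_sum fun l _ => (norm_bilin_le X (a l) (b l)).trans (le_of_eq ?_)
        rw [norm_glue_mul v (B l) (a l) (ha l), norm_glue_mul u (star (B l)) (b l) (hb l),
          norm_toLp_star]
        ring
    _ = _ := by rw [← Finset.mul_sum, hB, mul_one]

theorem conj_tensorState_single (U : QOp (ι ⊕ α)) (ψ : QOp α) (s t : ι → Fin 2)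
    (u v : ι ⊕ α → Fin 2) :
    conjBy U (tensorState ψ (Matrix.of fun x y => if x = s ∧ y = t then 1 else 0)) u v =
      ∑ z, ∑ z', ψ z z' * (U u (Sum.elim s z) * star (U v (Sum.elim t z'))) := by
  have h : ∀ (p q : ι → Fin 2) (z z' : α → Fin 2),
      tensorState ψ (Matrix.of fun x y => if x = s ∧ y = t then (1 : ℂ) else 0)
        (Sum.elim p z) (Sum.elim q z') = if p = s then (if q = t then ψ z z' else 0) else 0 := by
    intro p q z z'
    simp only [tensorState, LinearMap.coe_mk, AddHom.coe_mk, Matrix.of_apply, Sum.elim_inl,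
      Sum.elim_inr, ite_and, ite_mul, one_mul, zero_mul]
    rfl
  simp only [conjBy, LinearMap.coe_mk, AddHom.coe_mk, Matrix.mul_apply, sum_sumElim, h,
    Matrix.conjTranspose_apply, mul_ite, mul_zero, Finset.sum_ite_irrel, Finset.sum_const_zero,
    Finset.sum_ite_eq', Finset.mem_univ, if_true, ite_mul, zero_mul, Finset.sum_mul]
  rw [Finset.sum_comm]
  refine Finset.sum_congr rfl fun u _ => Finset.sum_congr rfl fun v _ => ?_
  ring

/-- The embedding of the output qubits into the register of a circuit. -/
def outputEmbedding {n k : ℕ} (hk : k ≤ n) (a : ℕ) : Fin k ↪ Fin n ⊕ Fin a :=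
  ⟨fun i => Sum.inl (Fin.castLE hk i), fun i j h => by
    simpa using Sum.inl_injective h⟩

/-- The partial trace pairs output indices with the references exactly as `eprProj` does, and the
factor `2^(-k)` is the normalization of that projection. The transpose appears because the Choi
entry at `s, t` carries `U` on the side of its row index `s`, while `V† P V` carries `U` on the side
of its column index. -/
theorem choi_implementedChannel {n a k : ℕ} (hk : k ≤ n) (U : QOp (Fin n ⊕ Fin a))
    (ψ : QOp (Fin a)) :
    ((2 : ℂ) ^ k)⁻¹ • choi (implementedChannel hk U ψ) =
      sliceTranspose ψ ((extendOp (Fin k) U).conjTranspose * eprProj (outputEmbedding hk a) *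
        extendOp (Fin k) U) := by
  classical
  ext s t
  have h1 : choi (implementedChannel hk U ψ) s t =
      partialTrace (outputEmbedding hk a) (conjBy U (tensorState ψ
        (Matrix.of fun x y => if x = s ∘ Sum.inr ∧ y = t ∘ Sum.inr then 1 else 0)))
        (s ∘ Sum.inl) (t ∘ Sum.inl) := rfl
  rw [Matrix.smul_apply, h1, sliceTranspose_apply]
  simp only [partialTrace, LinearMap.coe_mk, AddHom.coe_mk, Matrix.of_apply,
    conj_tensorState_single, glue, extendOp_conj_apply, smul_eq_mul, Finset.mul_sum,
    Finset.sum_mul]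
  have h2 : ∀ u v : Fin n ⊕ Fin a → Fin 2,
      eprProj (outputEmbedding hk a) (Sum.elim (t ∘ Sum.inl) v) (Sum.elim (s ∘ Sum.inl) u) =
        if (∀ i, u (outputEmbedding hk a i) = (s ∘ Sum.inl) i) ∧
          (∀ i, v (outputEmbedding hk a i) = (t ∘ Sum.inl) i) ∧
          (∀ j, j ∉ Set.range (outputEmbedding hk a) → u j = v j)
        then ((2 : ℂ) ^ k)⁻¹ else 0 := by
    intro u v
    simp only [eprProj, Matrix.of_apply, Fintype.card_fin, Sum.elim_inl, Sum.elim_inr]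
    refine if_congr ?_ rfl rfl
    constructor
    · rintro ⟨h, h', h''⟩
      exact ⟨fun i => (h' i).symm, fun i => (h i).symm, fun j hj => (h'' j hj).symm⟩
    · rintro ⟨h, h', h''⟩
      exact ⟨fun i => (h' i).symm, fun i => (h i).symm, fun j hj => (h'' j hj).symm⟩
  simp only [h2]
  have h3 : ∀ F : (Fin n ⊕ Fin a → Fin 2) → (Fin n ⊕ Fin a → Fin 2) → (Fin a → Fin 2) →
      (Fin a → Fin 2) → ℂ, ∑ z, ∑ z', ∑ u, ∑ v, F u v z z' = ∑ u, ∑ v, ∑ z, ∑ z', F u v z z' := by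
    intro F
    calc _ = ∑ z, ∑ u, ∑ z', ∑ v, F u v z z' :=
          Finset.sum_congr rfl fun z _ => Finset.sum_comm
      _ = ∑ u, ∑ z, ∑ z', ∑ v, F u v z z' := Finset.sum_comm
      _ = ∑ u, ∑ z, ∑ v, ∑ z', F u v z z' :=
          Finset.sum_congr rfl fun u _ => Finset.sum_congr rfl fun z _ => Finset.sum_comm
      _ = _ := Finset.sum_congr rfl fun u _ => Finset.sum_comm
  rw [h3]
  refine Finset.sum_congr rfl fun u _ => Finset.sum_congr rfl fun v _ => ?_
  split_ifs
  · simp only [Finset.mul_sum]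
    refine Finset.sum_congr rfl fun z _ => Finset.sum_congr rfl fun z' _ => ?_
    ring
  · simp

end Heisenberg

/-! ### The completely bounded norm bounds the Choi operator -/

section CompletelyBounded

open Matrix

theorem norm_ampliation_le {m p : Type} [Fintype m] [DecidableEq m] [Fintype p] [DecidableEq p]
    {E : Matrix m m ℂ →ₗ[ℂ] Matrix p p ℂ} {ε : ℝ} (hε : 0 ≤ ε)
    (h : cbSpectralNorm E ≤ ENNReal.ofReal ε) (r : ℕ) (X : Matrix (m × Fin r) (m × Fin r) ℂ) :
    ‖ampliation E X‖ ≤ ε * ‖X‖ := by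
  have h1 : ∀ Y : Matrix (m × Fin r) (m × Fin r) ℂ, ‖Y‖ ≤ 1 → ‖ampliation E Y‖ ≤ ε := by
    intro Y hY
    rw [← ENNReal.ofReal_le_ofReal_iff hε]
    refine le_trans ?_ h
    exact le_iSup_of_le r (le_iSup_of_le Y (le_iSup_of_le hY le_rfl))
  have hsmul : ∀ (c : ℂ) (Y : Matrix (m × Fin r) (m × Fin r) ℂ),
      ampliation E (c • Y) = c • ampliation E Y := by
    intro c Y
    ext s t
    change E (c • Matrix.of fun x y => Y (x, s.2) (y, t.2)) s.1 t.1 = _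
    rw [map_smul]; rfl
  rcases (norm_nonneg X).eq_or_lt with h0 | hpos
  · have hX : X = (0 : ℂ) • X := by rw [norm_eq_zero.1 h0.symm, smul_zero]
    rw [hX, hsmul]; simp
  · have h2 := h1 (((‖X‖ : ℝ) : ℂ)⁻¹ • X) (by
      rw [norm_smul, norm_inv, Complex.norm_real, norm_norm, inv_mul_cancel₀ hpos.ne'])
    rw [hsmul, norm_smul, norm_inv, Complex.norm_real, norm_norm, inv_mul_le_iff₀ hpos] at h2
    linarith

theorem norm_vecMulVec_le {m n : Type*} [Fintype m] [Fintype n] [DecidableEq m] [DecidableEq n]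
    (a : m → ℂ) (b : n → ℂ) :
    ‖vecMulVec a b‖ ≤ ‖(WithLp.toLp 2 a : EuclideanSpace ℂ m)‖ *
      ‖(WithLp.toLp 2 b : EuclideanSpace ℂ n)‖ := by
  refine l2_opNorm_le_of_bilin (by positivity) fun u v => ?_
  have h : u ⬝ᵥ vecMulVec a b *ᵥ v = (u ⬝ᵥ a) * (b ⬝ᵥ v) := by
    rw [vecMulVec_mulVec]
    simp [mul_comm]
  rw [h, norm_mul]
  calc _ ≤ _ := mul_le_mul (norm_dotProduct_le u a) (norm_dotProduct_le b v) (norm_nonneg _)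
        (by positivity)
    _ = _ := by ring

/-- Inserting `epr` directly into the norm would lose its norm `2^n`. Instead a reference of the
size of the output is used: the vectors `u` and `v` are read as vectors `a`, `b` on input and
reference, and the bilinear form of the Choi operator becomes that of the ampliation of a rank-one
operator of norm at most `‖u‖ ‖v‖`, evaluated at the unnormalized maximally entangled vector `ω`. As
`‖ω‖² = 2^k`, the factor `2^(-k)` compensates exactly. -/
theorem norm_smul_choi_le {ι κ : Type} [Fintype ι] [DecidableEq ι] [Fintype κ] [DecidableEq κ]
    {E : QOp ι →ₗ[ℂ] QOp κ} {ε : ℝ} (hε : 0 ≤ ε)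
    (h : cbSpectralNorm E ≤ ENNReal.ofReal ε) :
    ‖((2 : ℂ) ^ Fintype.card κ)⁻¹ • choi E‖ ≤ ε := by
  have hcard : Fintype.card (κ → Fin 2) = 2 ^ Fintype.card κ := by simp
  obtain ⟨e⟩ : Nonempty ((κ → Fin 2) ≃ Fin (2 ^ Fintype.card κ)) :=
    ⟨Fintype.equivFinOfCardEq hcard⟩
  rw [norm_smul, norm_inv, norm_pow, Complex.norm_ofNat, inv_mul_le_iff₀ (by positivity)]
  refine l2_opNorm_le_of_bilin (by positivity) fun u v => ?_
  -- the rank-one operator whose ampliation, tested against `ω`, gives the bilinear form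
  let a : (ι → Fin 2) × Fin (2 ^ Fintype.card κ) → ℂ := fun x => u (Sum.elim (e.symm x.2) x.1)
  let b : (ι → Fin 2) × Fin (2 ^ Fintype.card κ) → ℂ := fun x => v (Sum.elim (e.symm x.2) x.1)
  let ω : (κ → Fin 2) × Fin (2 ^ Fintype.card κ) → ℂ := fun x => if e x.1 = x.2 then 1 else 0
  have hnorm : ∀ w : (κ ⊕ ι → Fin 2) → ℂ,
      ‖(WithLp.toLp 2 (fun x : (ι → Fin 2) × Fin (2 ^ Fintype.card κ) =>
        w (Sum.elim (e.symm x.2) x.1)) : EuclideanSpace ℂ _)‖ =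
        ‖(WithLp.toLp 2 w : EuclideanSpace ℂ _)‖ := by
    intro w
    rw [EuclideanSpace.norm_eq, EuclideanSpace.norm_eq, sum_sumElim, Fintype.sum_prod_type,
      Finset.sum_comm, ← e.sum_comp]
    simp
  have hω : ‖(WithLp.toLp 2 ω : EuclideanSpace ℂ _)‖ * ‖(WithLp.toLp 2 ω : EuclideanSpace ℂ _)‖ =
      2 ^ Fintype.card κ := by
    rw [← pow_two, EuclideanSpace.norm_sq_eq, Fintype.sum_prod_type]
    simp [ω, apply_ite norm, ite_pow]
  have hE : ∀ X : QOp ι, E X = ∑ x, ∑ y, X x y • E (Matrix.single x y 1) := by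
    intro X
    conv_lhs => rw [Matrix.matrix_eq_sum_single X]
    simp only [map_sum]
    refine Finset.sum_congr rfl fun x _ => Finset.sum_congr rfl fun y _ => ?_
    rw [← map_smul, Matrix.smul_single, smul_eq_mul, mul_one]
  have hchoi : ∀ s t, choi E s t =
      E (Matrix.single (s ∘ Sum.inr) (t ∘ Sum.inr) 1) (s ∘ Sum.inl) (t ∘ Sum.inl) := by
    intro s t
    have : (Matrix.single (s ∘ Sum.inr) (t ∘ Sum.inr) 1 : QOp ι) =
        Matrix.of fun x y => if x = s ∘ Sum.inr ∧ y = t ∘ Sum.inr then 1 else 0 := by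
      ext x y
      simp only [Matrix.single_apply, Matrix.of_apply, eq_comm]
    rw [this]; rfl
  have key : u ⬝ᵥ choi E *ᵥ v = ω ⬝ᵥ ampliation E (vecMulVec a b) *ᵥ ω := by
    have hR : ∀ p q : κ → Fin 2, ampliation E (vecMulVec a b) (p, e p) (q, e q) =
        ∑ x, ∑ y, u (Sum.elim p x) * v (Sum.elim q y) * E (Matrix.single x y 1) p q := by
      intro p q
      simp only [ampliation, Matrix.of_apply]
      rw [hE]
      simp only [Matrix.sum_apply, Matrix.smul_apply, Matrix.of_apply, vecMulVec_apply, a, b,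
        Equiv.symm_apply_apply, smul_eq_mul]
    have hω' : ∀ f : (κ → Fin 2) × Fin (2 ^ Fintype.card κ) → ℂ,
        ω ⬝ᵥ f = ∑ p, f (p, e p) := by
      intro f
      simp [dotProduct, Fintype.sum_prod_type, ω]
    rw [hω']
    simp only [mulVec, dotProduct_comm _ ω, hω', hR]
    simp only [dotProduct, sum_sumElim, hchoi, Sum.elim_comp_inl, Sum.elim_comp_inr, mulVec,
      Finset.mul_sum]
    refine Finset.sum_congr rfl fun p _ => ?_
    rw [Finset.sum_comm]
    refine Finset.sum_congr rfl fun q _ => Finset.sum_congr rfl fun x _ =>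
      Finset.sum_congr rfl fun y _ => ?_
    ring
  rw [key]
  refine (norm_bilin_le _ ω ω).trans ?_
  rw [mul_assoc, hω]
  calc ‖ampliation E (vecMulVec a b)‖ * 2 ^ Fintype.card κ
      ≤ ε * (‖(WithLp.toLp 2 u : EuclideanSpace ℂ _)‖ *
        ‖(WithLp.toLp 2 v : EuclideanSpace ℂ _)‖) * 2 ^ Fintype.card κ := by
        gcongr
        refine (norm_ampliation_le hε h _ _).trans ?_
        gcongr
        refine (norm_vecMulVec_le a b).trans (le_of_eq ?_)
        rw [hnorm u, hnorm v]
    _ = _ := by ring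

end CompletelyBounded

/-! ### Approximate degree of implemented channels -/

theorem eprProj_eq_one {κ ι : Type} [Fintype κ] [Fintype ι] [DecidableEq κ] [DecidableEq ι]
    [IsEmpty κ] (o : κ ↪ ι) : eprProj o = 1 := by
  ext x y
  have h : (∀ j, x (Sum.inr j) = y (Sum.inr j)) ↔ x = y :=
    ⟨fun h => funext (Sum.rec isEmptyElim h), fun h j => h ▸ rfl⟩
  simp [eprProj, Matrix.one_apply, h]

theorem natLog_add_one_le {N : ℕ} {m : ℝ} (hN : 1 ≤ N) (hm : 1 ≤ m) (hNm : (N : ℝ) ≤ 2 * m) :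
    ((Nat.log 2 N + 1 : ℕ) : ℝ) ≤ 2 * (1 + Real.log m) := by
  have hN0 : (0 : ℝ) < N := by exact_mod_cast hN
  have h1 : (Nat.log 2 N : ℝ) ≤ Real.logb 2 N := by exact_mod_cast Real.natLog_le_logb N 2
  have h2 : Real.logb 2 N ≤ Real.logb 2 (2 * m) :=
    Real.logb_le_logb_of_le one_lt_two hN0 hNm
  have h3 : Real.logb 2 (2 * m) = 1 + Real.log m / Real.log 2 := by
    rw [Real.logb_mul two_ne_zero (by linarith), Real.logb_self_eq_one one_lt_two, Real.logb]
  have h4 : Real.log m / Real.log 2 ≤ 2 * Real.log m := by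
    rw [div_le_iff₀ (Real.log_pos one_lt_two)]
    nlinarith [Real.log_two_gt_d9, Real.log_nonneg hm]
  push_cast
  linarith

/-- The total exponent of `K` is `3/2 - q/2 ≤ 2`, which accounts for the squared logarithm; `800` is
`20²` from `K ≤ 20 L` times `2` from `N ≤ 2m`. -/
theorem degree_bound_le {K N m k q L : ℝ} (hK : 1 ≤ K) (hN : 0 < N) (hm : 1 ≤ m)
    (hNm : N ≤ 2 * m) (hk : 0 ≤ k) (hq : 0 < q) (hq1 : q ≤ 1) (hKL : K ≤ 20 * L) :
    K ^ (3 / 2 * (1 - q)) * N ^ (1 - q) * (K * √k) ^ q ≤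
      800 * m ^ (1 - q) * k ^ (q / 2) * L ^ 2 := by
  have hK0 : 0 < K := by linarith
  have h1 : (K * √k) ^ q = K ^ q * k ^ (q / 2) := by
    rw [Real.mul_rpow hK0.le (Real.sqrt_nonneg k), Real.sqrt_eq_rpow, ← Real.rpow_mul hk]
    congr 2; ring
  have h2 : K ^ (3 / 2 * (1 - q)) * K ^ q ≤ 400 * L ^ 2 := by
    rw [← Real.rpow_add hK0]
    calc K ^ (3 / 2 * (1 - q) + q) ≤ K ^ (2 : ℝ) :=
          Real.rpow_le_rpow_of_exponent_le hK (by linarith)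
      _ = K ^ 2 := Real.rpow_two K
      _ ≤ (20 * L) ^ 2 := by gcongr
      _ = 400 * L ^ 2 := by ring
  have h3 : N ^ (1 - q) ≤ 2 * m ^ (1 - q) := by
    calc N ^ (1 - q) ≤ (2 * m) ^ (1 - q) :=
          Real.rpow_le_rpow hN.le hNm (by linarith)
      _ = 2 ^ (1 - q) * m ^ (1 - q) := Real.mul_rpow (by norm_num) (by linarith)
      _ ≤ 2 ^ (1 : ℝ) * m ^ (1 - q) := by
          gcongr
          · exact one_le_two
          · linarith
      _ = 2 * m ^ (1 - q) := by rw [Real.rpow_one]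
  calc K ^ (3 / 2 * (1 - q)) * N ^ (1 - q) * (K * √k) ^ q
      = (K ^ (3 / 2 * (1 - q)) * K ^ q) * N ^ (1 - q) * k ^ (q / 2) := by rw [h1]; ring
    _ ≤ (400 * L ^ 2) * (2 * m ^ (1 - q)) * k ^ (q / 2) := by gcongr
    _ = _ := by ring

theorem exists_approx_choi {n a d k : ℕ} (hn : 1 ≤ n) (hd : 1 ≤ d) (hk : k ≤ n)
    {U : QOp (Fin n ⊕ Fin a)} (hU : IsQACCircuit d U) {ψ : QOp (Fin a)} (hψ : IsDensity ψ) :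
    ∃ (l : ℕ) (B : QOp (Fin k ⊕ Fin n)), B ∈ degLE (Fin k ⊕ Fin n) l ∧
      ‖((2 : ℂ) ^ k)⁻¹ • choi (implementedChannel hk U ψ) - B‖ ≤ 5 * (d : ℝ) / n ∧
      (l : ℝ) ≤ 800 * ((n : ℝ) + (a : ℝ)) ^ (1 - ((3 : ℝ) ^ d)⁻¹) *
        (k : ℝ) ^ (((3 : ℝ) ^ d)⁻¹ / 2) * (1 + Real.log ((n : ℝ) + (a : ℝ))) ^ 2 := by
  have hn1 : (1 : ℝ) ≤ n := by exact_mod_cast hn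
  have hm1 : (1 : ℝ) ≤ n + a := le_add_of_le_of_nonneg hn1 (Nat.cast_nonneg a)
  set o := outputEmbedding hk a with ho
  set V := extendOp (Fin k) U with hV
  have hVc : IsQACCircuit d V := hU.extendOp
  rw [choi_implementedChannel, ← hV, ← ho]
  -- For `k = 0` the bound on `l` is zero because the exponent of `k` is positive. The projection is
  -- then the identity, and the normalized Choi operator has degree `0` exactly.
  rcases Nat.eq_zero_or_pos k with rfl | hkpos
  · rw [eprProj_eq_one, mul_one, hVc.conjTranspose_mul_self]
    refine ⟨0, sliceTranspose ψ 1, sliceTranspose_mem_degLE ψ (one_mem_degLE 0), ?_, ?_⟩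
    · rw [sub_self, norm_zero]; positivity
    · have := Real.log_nonneg hm1
      rw [Nat.cast_zero]; positivity
  have hd1 : (1 : ℝ) ≤ d := by exact_mod_cast hd
  have : Nonempty (Fin k ⊕ (Fin n ⊕ Fin a)) := ⟨Sum.inl ⟨0, hkpos⟩⟩
  have hcard : Fintype.card (Fin k ⊕ (Fin n ⊕ Fin a)) = k + (n + a) := by simp
  set N : ℕ := Fintype.card (Fin k ⊕ (Fin n ⊕ Fin a)) with hN
  -- The least order of precision at which `4^(-s)` is guaranteed to be at most `N^(-2)`; this is
  -- the source of the logarithms.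
  set s : ℕ := Nat.log 2 N + 1 with hs
  have hs1 : 1 ≤ s := Nat.le_add_left 1 _
  have hN2 : N ≤ 2 ^ s := (Nat.lt_pow_succ_log_self one_lt_two N).le
  have hN1 : 1 ≤ N := by omega
  have hN0 : (0 : ℝ) < N := by exact_mod_cast hN1
  have hnN : (n : ℝ) ≤ N := by rw [hcard]; exact_mod_cast (by omega : n ≤ k + (n + a))
  have hNm : (N : ℝ) ≤ 2 * (n + a) := by
    rw [hcard]; exact_mod_cast (by omega : k + (n + a) ≤ 2 * (n + a))
  have hs1' : (1 : ℝ) ≤ s := by exact_mod_cast hs1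
  have hkR : (1 : ℝ) ≤ k := by exact_mod_cast hkpos
  obtain ⟨l₀, B₀, hB₀, hB₀n, hB₀e, hl₀⟩ := exists_approx_eprProj o s (by rwa [Fintype.card_fin])
  rw [Fintype.card_fin] at hl₀
  obtain ⟨l, B, hB, -, hBe, hl⟩ := exists_approx_circuit_conj hs1 hN2 hVc hB₀n hB₀
    (D := 10 * s * √k) (by positivity) hl₀
  refine ⟨l, sliceTranspose ψ B, sliceTranspose_mem_degLE ψ hB, ?_, hl.trans ?_⟩
  · rw [← map_sub]
    refine (norm_sliceTranspose_le hψ _).trans ?_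
    have h1 : V.conjTranspose * eprProj o * V - B =
        V.conjTranspose * (eprProj o - B₀) * V + (V.conjTranspose * B₀ * V - B) := by
      noncomm_ring
    have h2 : ((1 : ℝ) / 4) ^ s ≤ 1 / N := by
      rw [one_div_pow]
      refine one_div_le_one_div_of_le hN0 ?_
      calc (N : ℝ) ≤ 2 ^ s := by exact_mod_cast hN2
        _ ≤ 4 ^ s := by gcongr; norm_num
    rw [h1]
    calc _ ≤ _ := norm_add_le _ _
      _ ≤ 1 / N + d * (4 / N) :=
          add_le_add ((norm_conj_le hVc.conjTranspose_mul_self _).trans (hB₀e.trans h2)) hBe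
      -- The initial error of the entangled projection is charged to the first layer, using `1 ≤ d`;
      -- this gives the constant `5 = 1 + 4`.
      _ ≤ d / N + d * (4 / N) := by gcongr
      _ = 5 * d / N := by ring
      _ ≤ 5 * d / n := by gcongr
  · have hq : ((3 : ℝ) ^ d)⁻¹ ≤ 1 := inv_le_one_of_one_le₀ (one_le_pow₀ (by norm_num))
    refine degree_bound_le (by linarith) hN0 hm1 hNm (Nat.cast_nonneg k) (by positivity) hq ?_
    have := natLog_add_one_le hN1 hm1 hNm
    rw [← hs] at this
    linarith

end

theorem mainTheorem8 :
    ∃ (C₁ C₂ : ℝ) (c : ℕ), 0 < C₁ ∧ 0 < C₂ ∧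
      ∀ (n a d k : ℕ) (_ : 1 ≤ n) (_ : 1 ≤ d) (hk : k ≤ n)
        (U : QOp (Fin n ⊕ Fin a)) (_ : IsQACCircuit d U)
        (ψ : QOp (Fin a)) (_ : IsDensity ψ),
        (approxDegree (C₁ * (d : ℝ) / (n : ℝ))
            (((2 : ℂ) ^ k)⁻¹ • choi (implementedChannel hk U ψ)) : ℝ) ≤
          C₂ * ((n : ℝ) + (a : ℝ)) ^ (1 - ((3 : ℝ) ^ d)⁻¹) * (k : ℝ) ^ (((3 : ℝ) ^ d)⁻¹ / 2) *
            (1 + Real.log ((n : ℝ) + (a : ℝ))) ^ c ∧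
        ∀ (E : QOp (Fin n) →ₗ[ℂ] QOp (Fin k)) (_ : IsQuantumChannel E)
          (ε : ℝ) (_ : 0 ≤ ε) (_ : ε ≤ 1)
          (_ : cbSpectralNorm (E - implementedChannel hk U ψ) ≤ ENNReal.ofReal ε),
          (approxDegree (ε + C₁ * (d : ℝ) / (n : ℝ)) (((2 : ℂ) ^ k)⁻¹ • choi E) : ℝ) ≤
            C₂ * ((n : ℝ) + (a : ℝ)) ^ (1 - ((3 : ℝ) ^ d)⁻¹) * (k : ℝ) ^ (((3 : ℝ) ^ d)⁻¹ / 2) *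
              (1 + Real.log ((n : ℝ) + (a : ℝ))) ^ c := by
  refine ⟨5, 800, 2, by norm_num, by norm_num, fun n a d k hn hd hk U hU ψ hψ => ?_⟩
  obtain ⟨l, B, hB, hBe, hl⟩ := exists_approx_choi hn hd hk hU hψ
  refine ⟨(Nat.cast_le.2 (approxDegree_le hB hBe)).trans hl, fun E _ ε hε _ hEε => ?_⟩
  -- The approximant `B` of the implemented channel is reused for `E`; only the error grows, by `ε`.
  refine (Nat.cast_le.2 (approxDegree_le hB ?_)).trans hl
  have h1 := norm_smul_choi_le hε hEε
  rw [Fintype.card_fin] at h1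
  have h2 : ((2 : ℂ) ^ k)⁻¹ • choi E - B =
      ((2 : ℂ) ^ k)⁻¹ • choi (E - implementedChannel hk U ψ) +
        (((2 : ℂ) ^ k)⁻¹ • choi (implementedChannel hk U ψ) - B) := by
    have : choi (E - implementedChannel hk U ψ) = choi E - choi (implementedChannel hk U ψ) := rfl
    rw [this, smul_sub]
    abel
  rw [h2]
  exact (norm_add_le _ _).trans (add_le_add h1 hBe)
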